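/- Let $(\mathbb F_1,\mathbb F_2)$ be one of $(\mathbb R,\mathbb R)$, $(\mathbb C,\mathbb C)$, $(\mathbb C,\mathbb R)$, and let $G$ be a discrete group. An $\mathbb F_1$-operator space is an $\mathbb F_1$-linear subspace $X\subseteq B(\mathcal H)$ for a Hilbert space $\mathcal H$ over $\mathbb F_1$; it is unital if it contains the identity operator, and an operator system if it is moreover closed under adjoints. $M_n(X)$ carries the norm and the positive elements of $B(\mathcal H^n)$. Let $\mathsf{OSp}_{(\mathbb F_1,\mathbb F_2)}$ (resp. $\mathsf{OSp}^{\mathbb 1}_{(\mathbb F_1,\mathbb F_2)}$, $\mathsf{OSy}_{(\mathbb F_1,\mathbb F_2)}$) be the category of $\mathbb F_1$-operator spaces (resp. unital $\mathbb F_1$-operator spaces, $\mathbb F_1$-operator systems) whose morphisms are the completely contractive (resp. unital completely contractive, unital completely positive) $\mathbb F_2$-linear maps. The categories $\mathsf{OSp}^{G}_{(\mathbb F_1,\mathbb F_2)}$, $\mathsf{OSp}^{\mathbb 1,G}_{(\mathbb F_1,\mathbb F_2)}$, $\mathsf{OSy}^{G}_{(\mathbb F_1,\mathbb F_2)}$ have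 as objects such spaces with an action of $G$ by $\mathbb F_1$-linear surjective complete isometries (resp. unital surjective complete isometries, unital complete order isomorphisms), and as morphisms the $G$-equivariant ones. An object $Z$ of one of these six categories is injective if for all objects $A,B$, every $\mathbb F_2$-linear (and, in the $G$-categories, $G$-equivariant; for unital spaces and systems, unital) complete isometry $\kappa:A\to B$ and every morphism $\varphi:A\to Z$ there is a morphism $\tilde\varphi:B\to Z$ with $\tilde\varphi\circ\kappa=\varphi$ and $\|\tilde\varphi\|_{cb}=\|\varphi\|_{cb}$. Let $X\subseteq B(\mathcal H)$ be an object of $\mathsf{OSp}^{G}_{(\mathbb F_1,\mathbb F_2)}$ (resp. $\mathsf{OSp}^{\mathbb 1,G}_{(\mathbb F_1,\mathbb F_2)}$, $\mathsf{OSy}^{G}_{(\mathbb F_1,\mathbb F_2)}$). Let $\ell^\infty(G,X)$ be the space of bounded functions $G\to X$, regarded as diagonal operators on $\ell^2(G,\mathcal H)$, with the action $(tf)(s)=f(t^{-1}s)$, and let $j:X\to\ell^\infty(G,X)$, $j(x)(s)=s^{-1}x$. Then $X$ is injective in $\mathsf{OSp}^{G}_{(\mathbb F_1,\mathbb F_2)}$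 (resp. $\mathsf{OSp}^{\mathbb 1,G}_{(\mathbb F_1,\mathbb F_2)}$, $\mathsf{OSy}^{G}_{(\mathbb F_1,\mathbb F_2)}$) if and only if 1. $X$ is injective in $\mathsf{OSp}_{(\mathbb F_1,\mathbb F_2)}$ (resp. $\mathsf{OSp}^{\mathbb 1}_{(\mathbb F_1,\mathbb F_2)}$, $\mathsf{OSy}_{(\mathbb F_1,\mathbb F_2)}$), and 2. there is a $G$-equivariant completely contractive (resp. unital completely contractive, unital completely positive) $\mathbb F_2$-linear idempotent map $\phi:\ell^\infty(G,X)\to\ell^\infty(G,X)$ with range $j(X)$ and $\phi\circ j=j$ (that is, $\phi\circ j=\mathrm{Id}_X$ once $X$ is identified with $j(X)$ through $j$). -/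

import Mathlib

noncomputable section

namespace OpSp

open scoped ENNReal

universe u

/-! ### Matrices of operators -/

section Matrices

variable {𝕜 : Type} [RCLike 𝕜] {H : Type u} [NormedAddCommGroup H] [InnerProductSpace 𝕜 H]

/-- The operator on the Hilbert space `Hⁿ` given by an `n × n` matrix of operators on `H`. -/
def matOp {n : ℕ} (a : Matrix (Fin n) (Fin n) (H →L[𝕜] H)) :
    PiLp 2 (fun _ : Fin n => H) →L[𝕜] PiLp 2 (fun _ : Fin n => H) :=
  (PiLp.continuousLinearEquiv 2 𝕜 (fun _ : Fin n => H)).symm.toContinuousLinearMap ∘L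
    ContinuousLinearMap.pi (fun i => ∑ j, (a i j) ∘L PiLp.proj 2 (fun _ : Fin n => H) j)

theorem matOp_apply {n : ℕ} (a : Matrix (Fin n) (Fin n) (H →L[𝕜] H))
    (v : PiLp 2 (fun _ : Fin n => H)) (i : Fin n) : matOp a v i = ∑ j, a i j (v j) := by
  simp [matOp]

end Matrices

/-- A `𝕜`-operator space: a `𝕜`-vector space `V` identified, through an injective linear map, with
a linear subspace of `B(H)` for a Hilbert space `H` over `𝕜`. -/
structure OperatorSpace (𝕜 : Type) [RCLike 𝕜] where
  V : Type u
  [addCommGroup : AddCommGroup V]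
  [module : Module 𝕜 V]
  H : Type u
  [normedAddCommGroup : NormedAddCommGroup H]
  [innerProductSpace : InnerProductSpace 𝕜 H]
  [completeSpace : CompleteSpace H]
  toOp : V →ₗ[𝕜] (H →L[𝕜] H)
  toOp_injective : Function.Injective toOp

attribute [instance] OperatorSpace.addCommGroup OperatorSpace.module
  OperatorSpace.normedAddCommGroup OperatorSpace.innerProductSpace OperatorSpace.completeSpace

namespace OperatorSpace

variable {𝕜 : Type} [RCLike 𝕜]

/-- The operator on `Hⁿ` represented by an element of `Mₙ(X)`. -/
def mat (X : OperatorSpace.{u} 𝕜) {n : ℕ} (a : Matrix (Fin n) (Fin n) X.V) :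
    PiLp 2 (fun _ : Fin n => X.H) →L[𝕜] PiLp 2 (fun _ : Fin n => X.H) :=
  matOp (a.map X.toOp)

/-- The norm of `Mₙ(X)`. -/
def matNorm (X : OperatorSpace.{u} 𝕜) {n : ℕ} (a : Matrix (Fin n) (Fin n) X.V) : ℝ := ‖X.mat a‖

/-- The positive elements of `Mₙ(X)` (positivity includes self-adjointness). -/
def MatPos (X : OperatorSpace.{u} 𝕜) {n : ℕ} (a : Matrix (Fin n) (Fin n) X.V) : Prop :=
  (X.mat a).IsPositive

/-- `X` contains the identity operator. -/
def IsUnital (X : OperatorSpace.{u} 𝕜) : Prop := ∃ x : X.V, X.toOp x = 1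

/-- `X` is an operator system: unital and closed under taking adjoints. -/
def IsSystem (X : OperatorSpace.{u} 𝕜) : Prop :=
  X.IsUnital ∧ ∀ x : X.V, ∃ y : X.V, X.toOp y = star (X.toOp x)

end OperatorSpace

/-! ### Maps between operator spaces -/

section Maps

variable {𝕜 : Type} [RCLike 𝕜] {X Y : OperatorSpace.{u} 𝕜}

/-- Linearity over a field `F₂` of scalars contained in `𝕜`. -/
structure IsLinearOver (F₂ : Type) [RCLike F₂] [NormedAlgebra F₂ 𝕜] (T : X.V → Y.V) : Prop where
  map_add : ∀ x y, T (x + y) = T x + T y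
  map_smul : ∀ (c : F₂) (x), T (algebraMap F₂ 𝕜 c • x) = algebraMap F₂ 𝕜 c • T x

/-- `T` maps the identity to the identity. -/
def MapsUnit (T : X.V → Y.V) : Prop := ∀ x, X.toOp x = 1 → Y.toOp (T x) = 1

/-- All amplifications `Tₙ : Mₙ(X) → Mₙ(Y)` are contractive. -/
def CompletelyContractive (T : X.V → Y.V) : Prop :=
  ∀ (n : ℕ) (a : Matrix (Fin n) (Fin n) X.V), Y.matNorm (a.map T) ≤ X.matNorm a

/-- All amplifications `Tₙ : Mₙ(X) → Mₙ(Y)` are isometric. -/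
def CompletelyIsometric (T : X.V → Y.V) : Prop :=
  ∀ (n : ℕ) (a : Matrix (Fin n) (Fin n) X.V), Y.matNorm (a.map T) = X.matNorm a

/-- All amplifications `Tₙ : Mₙ(X) → Mₙ(Y)` preserve positivity. -/
def CompletelyPositive (T : X.V → Y.V) : Prop :=
  ∀ (n : ℕ) (a : Matrix (Fin n) (Fin n) X.V), X.MatPos a → Y.MatPos (a.map T)

/-- All amplifications `Tₙ : Mₙ(X) → Mₙ(Y)` preserve and reflect positivity. -/
def CompleteOrderEmbedding (T : X.V → Y.V) : Prop :=
  ∀ (n : ℕ) (a : Matrix (Fin n) (Fin n) X.V), X.MatPos a ↔ Y.MatPos (a.map T)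

/-- The completely bounded norm of `T`, the supremum over `n` of the norms of the maps `Tₙ`. -/
def cbNorm (T : X.V → Y.V) : ℝ≥0∞ :=
  ⨆ (n : ℕ) (a : Matrix (Fin n) (Fin n) X.V) (_ : X.matNorm a ≤ 1),
    ENNReal.ofReal (Y.matNorm (a.map T))

/-- `T` intertwines the actions `ρ` and `σ` of `G`. -/
def IsEquivariant {G : Type u} [Group G] (ρ : Representation 𝕜 G X.V) (σ : Representation 𝕜 G Y.V)
    (T : X.V → Y.V) : Prop := ∀ g x, T (ρ g x) = σ g (T x)

end Maps

/-! ### The categories -/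

/-- The three kinds of categories: operator spaces, unital operator spaces, operator systems. -/
inductive Kind
  | OSp
  | OSp1
  | OSy

namespace Kind

variable {𝕜 : Type} [RCLike 𝕜]

/-- The objects of the category of the given kind. -/
def IsObject : Kind → OperatorSpace.{u} 𝕜 → Prop
  | OSp, _ => True
  | OSp1, X => X.IsUnital
  | OSy, X => X.IsSystem

/-- The `F₂`-linear morphisms: completely contractive, unital completely contractive, and unital
completely positive maps. -/
def IsMorphism (k : Kind) (F₂ : Type) [RCLike F₂] [NormedAlgebra F₂ 𝕜]
    {X Y : OperatorSpace.{u} 𝕜} (T : X.V → Y.V) : Prop :=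
  IsLinearOver F₂ T ∧
    match k with
    | OSp => CompletelyContractive T
    | OSp1 => MapsUnit T ∧ CompletelyContractive T
    | OSy => MapsUnit T ∧ CompletelyPositive T

/-- The `F₂`-linear embeddings: complete isometries, unital for the two unital kinds. -/
def IsEmbedding (k : Kind) (F₂ : Type) [RCLike F₂] [NormedAlgebra F₂ 𝕜]
    {X Y : OperatorSpace.{u} 𝕜} (T : X.V → Y.V) : Prop :=
  IsLinearOver F₂ T ∧
    match k with
    | OSp => CompletelyIsometric T
    | OSp1 => MapsUnit T ∧ CompletelyIsometric T
    | OSy => MapsUnit T ∧ CompletelyIsometric T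

/-- The `𝕜`-linear maps by which a group may act: complete isometries, unital complete
isometries, and unital complete order isomorphisms (bijectivity is automatic for a group action). -/
def IsActionMap (k : Kind) {X : OperatorSpace.{u} 𝕜} (T : X.V →ₗ[𝕜] X.V) : Prop :=
  match k with
  | OSp => CompletelyIsometric (X := X) (Y := X) T
  | OSp1 => MapsUnit (X := X) (Y := X) T ∧ CompletelyIsometric (X := X) (Y := X) T
  | OSy => MapsUnit (X := X) (Y := X) T ∧ CompleteOrderEmbedding (X := X) (Y := X) T

end Kind

/-- A `𝕜`-`G`-operator space, unital `𝕜`-`G`-operator space or `𝕜`-`G`-operator system. -/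
structure GObject (k : Kind) (𝕜 : Type) [RCLike 𝕜] (G : Type u) [Group G] where
  space : OperatorSpace.{u} 𝕜
  isObject : k.IsObject space
  act : Representation 𝕜 G space.V
  isActionMap : ∀ g, k.IsActionMap (act g)

section Injectivity

variable {𝕜 : Type} [RCLike 𝕜]

/-- Injectivity in the category of kind `k` of `𝕜`-operator spaces and `F₂`-linear morphisms. -/
def IsInjective (k : Kind) (F₂ : Type) [RCLike F₂] [NormedAlgebra F₂ 𝕜]
    (Z : OperatorSpace.{u} 𝕜) : Prop :=
  ∀ X Y : OperatorSpace.{u} 𝕜, k.IsObject X → k.IsObject Y →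
    ∀ κ : X.V → Y.V, k.IsEmbedding F₂ κ →
    ∀ φ : X.V → Z.V, k.IsMorphism F₂ φ →
    ∃ ψ : Y.V → Z.V, k.IsMorphism F₂ ψ ∧ (∀ x, ψ (κ x) = φ x) ∧ cbNorm ψ = cbNorm φ

/-- Injectivity in the `G`-category of kind `k` of `𝕜`-`G`-operator spaces and `G`-equivariant
`F₂`-linear morphisms. -/
def IsGInjective {k : Kind} {G : Type u} [Group G] (F₂ : Type) [RCLike F₂] [NormedAlgebra F₂ 𝕜]
    (Z : GObject k 𝕜 G) : Prop :=
  ∀ X Y : GObject k 𝕜 G,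
    ∀ κ : X.space.V → Y.space.V, k.IsEmbedding F₂ κ → IsEquivariant X.act Y.act κ →
    ∀ φ : X.space.V → Z.space.V, k.IsMorphism F₂ φ → IsEquivariant X.act Z.act φ →
    ∃ ψ : Y.space.V → Z.space.V, k.IsMorphism F₂ ψ ∧ IsEquivariant Y.act Z.act ψ ∧
      (∀ x, ψ (κ x) = φ x) ∧ cbNorm ψ = cbNorm φ

end Injectivity

/-! ### The space `ℓ^∞(G, X)` -/

section LInf

variable {𝕜 : Type} [RCLike 𝕜] (G : Type u)

/-- The bounded functions from `G` to `X`. -/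
def boundedFunctions (X : OperatorSpace.{u} 𝕜) : Submodule 𝕜 (G → X.V) where
  carrier := {f | ∃ C : ℝ, ∀ s, ‖X.toOp (f s)‖ ≤ C}
  zero_mem' := ⟨0, fun s => by simp⟩
  add_mem' := by
    rintro f g ⟨C, hC⟩ ⟨D, hD⟩
    refine ⟨C + D, fun s => ?_⟩
    rw [Pi.add_apply, map_add]
    exact (norm_add_le _ _).trans (add_le_add (hC s) (hD s))
  smul_mem' := by
    rintro c f ⟨C, hC⟩
    refine ⟨‖c‖ * C, fun s => ?_⟩
    rw [Pi.smul_apply, map_smul, norm_smul]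
    exact mul_le_mul_of_nonneg_left (hC s) (norm_nonneg _)

variable {G} {H : Type u} [NormedAddCommGroup H] [InnerProductSpace 𝕜 H]

theorem diag_memlp {f : G → H →L[𝕜] H} {C : ℝ} (hC : ∀ s, ‖f s‖ ≤ C)
    (v : lp (fun _ : G => H) 2) : Memℓp (fun s => f s (v s)) 2 := by
  have h := ((lp.memℓp v).norm).const_mul C
  refine h.mono fun s => ?_
  exact ((f s).le_opNorm _).trans (mul_le_mul_of_nonneg_right (hC s) (norm_nonneg _))

/-- The diagonal operator on `ℓ²(G, H)` given by a bounded family of operators on `H`. -/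
def diagOp (f : G → H →L[𝕜] H) (hf : ∃ C : ℝ, ∀ s, ‖f s‖ ≤ C) :
    lp (fun _ : G => H) 2 →L[𝕜] lp (fun _ : G => H) 2 :=
  LinearMap.mkContinuousOfExistsBound
    { toFun := fun v => ⟨fun s => f s (v s), diag_memlp hf.choose_spec v⟩
      map_add' := fun v w => by
        apply lp.ext; funext s; exact map_add (f s) (v s) (w s)
      map_smul' := fun c v => by
        apply lp.ext; funext s; exact map_smul (f s) c (v s) }
    (by
      obtain ⟨C, hC⟩ := hf
      refine ⟨|C|, fun v => ?_⟩
      have h : ‖(C : 𝕜) • v‖ = |C| * ‖v‖ := by rw [norm_smul, RCLike.norm_ofReal]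
      rw [← h]
      refine lp.norm_mono (by simp) fun s => ?_
      change ‖f s (v s)‖ ≤ ‖(C : 𝕜) • v s‖
      rw [norm_smul, RCLike.norm_ofReal]
      exact ((f s).le_opNorm _).trans
        (mul_le_mul_of_nonneg_right ((hC s).trans (le_abs_self C)) (norm_nonneg _)))

theorem diagOp_apply (f : G → H →L[𝕜] H) (hf : ∃ C : ℝ, ∀ s, ‖f s‖ ≤ C)
    (v : lp (fun _ : G => H) 2) (s : G) : diagOp f hf v s = f s (v s) := rfl

variable (G)

/-- `ℓ^∞(G, X)`: the bounded functions from `G` to `X`, acting diagonally on `ℓ²(G, H)`. -/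
def ellInf (X : OperatorSpace.{u} 𝕜) : OperatorSpace.{u} 𝕜 where
  V := boundedFunctions G X
  H := lp (fun _ : G => X.H) 2
  toOp :=
    { toFun := fun f => diagOp (fun s => X.toOp (f.1 s)) f.2
      map_add' := fun f g => by
        ext v s
        change X.toOp (f.1 s + g.1 s) (v s) = X.toOp (f.1 s) (v s) + X.toOp (g.1 s) (v s)
        rw [map_add]; rfl
      map_smul' := fun c f => by
        ext v s
        change X.toOp (c • f.1 s) (v s) = c • X.toOp (f.1 s) (v s)
        rw [map_smul]; rfl }
  toOp_injective := by
    classical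
    intro f g h
    apply Subtype.ext
    funext s
    apply X.toOp_injective
    ext w
    let δ : lp (fun _ : G => X.H) 2 := lp.single (E := fun _ : G => X.H) 2 s w
    have hδ : δ s = w := lp.single_apply_self (E := fun _ : G => X.H) 2 s w
    have h1 := congrArg (fun T : lp (fun _ : G => X.H) 2 →L[𝕜] lp (fun _ : G => X.H) 2 =>
      T δ s) h
    change X.toOp (f.1 s) (δ s) = X.toOp (g.1 s) (δ s) at h1
    rwa [hδ] at h1

/-- The translation action `(t f)(s) = f(t⁻¹ s)` of `G` on `ℓ^∞(G, X)`. -/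
def translation [Group G] (X : OperatorSpace.{u} 𝕜) : Representation 𝕜 G (ellInf G X).V where
  toFun t :=
    { toFun := fun f => ⟨fun s => f.1 (t⁻¹ * s), f.2.imp fun _ hC s => hC (t⁻¹ * s)⟩
      map_add' := fun _ _ => rfl
      map_smul' := fun _ _ => rfl }
  map_one' := by
    ext f
    apply Subtype.ext
    funext s
    change f.1 (1⁻¹ * s) = f.1 s
    simp
  map_mul' t r := by
    ext f
    apply Subtype.ext
    funext s
    change f.1 ((t * r)⁻¹ * s) = f.1 (r⁻¹ * (t⁻¹ * s))
    simp [mul_assoc]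

end LInf

/-! ### The canonical embedding of a `G`-object `X` into `ℓ^∞(G, X)` -/

section Embedding

variable {𝕜 : Type} [RCLike 𝕜]

theorem norm_matOp_one {H : Type u} [NormedAddCommGroup H] [InnerProductSpace 𝕜 H]
    (a : Matrix (Fin 1) (Fin 1) (H →L[𝕜] H)) : ‖matOp a‖ = ‖a 0 0‖ := by
  have hn : ∀ v : PiLp 2 (fun _ : Fin 1 => H), ‖v‖ = ‖v 0‖ := fun v => by
    rw [PiLp.norm_eq_of_L2]; simp
  apply le_antisymm
  · refine ContinuousLinearMap.opNorm_le_bound _ (norm_nonneg _) fun v => ?_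
    rw [hn, hn, matOp_apply]
    simpa using (a 0 0).le_opNorm (v 0)
  · refine ContinuousLinearMap.opNorm_le_bound _ (norm_nonneg _) fun w => ?_
    have h := (matOp a).le_opNorm (WithLp.toLp 2 fun _ : Fin 1 => w)
    rw [hn, hn, matOp_apply] at h
    simpa using h

/-- Unital completely positive maps of operator systems are contractive. -/
theorem norm_le_of_completelyPositive {X Y : OperatorSpace.{u} 𝕜} (hX : X.IsSystem)
    (T : X.V →ₗ[𝕜] Y.V) (h1 : MapsUnit (X := X) (Y := Y) T)
    (hT : CompletelyPositive (X := X) (Y := Y) T) (x : X.V) : ‖Y.toOp (T x)‖ ≤ ‖X.toOp x‖ := by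
  obtain ⟨⟨e, he⟩, hs⟩ := hX
  obtain ⟨x', hx'⟩ := hs x
  have hTe := h1 e he
  rcases eq_or_ne x 0 with rfl | hx
  · simp
  set c : ℝ := ‖X.toOp x‖ with hc
  have hc0 : 0 < c := by
    rw [hc, norm_pos_iff]
    intro h0
    exact hx (X.toOp_injective (by rw [h0, map_zero]))
  let a : Matrix (Fin 2) (Fin 2) X.V := !![(c : 𝕜) • e, x; x', (c : 𝕜) • e]
  have key : ∀ v w, inner 𝕜 (X.toOp x v) w = inner 𝕜 v (X.toOp x' w) := fun v w => by
    rw [hx', ContinuousLinearMap.star_eq_adjoint, ContinuousLinearMap.adjoint_inner_right]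
  have key' : ∀ v w, inner 𝕜 (X.toOp x' v) w = inner 𝕜 v (X.toOp x w) := fun v w => by
    rw [hx', ContinuousLinearMap.star_eq_adjoint, ContinuousLinearMap.adjoint_inner_left]
  have hpos : X.MatPos a := by
    constructor
    · intro v w
      simp only [ContinuousLinearMap.coe_coe, OperatorSpace.mat, PiLp.inner_apply, matOp_apply,
        Fin.sum_univ_two]
      simp [a, he, inner_add_left, inner_add_right, inner_smul_left, inner_smul_right, key, key']
      ring
    · intro v
      simp only [ContinuousLinearMap.reApplyInnerSelf_apply, OperatorSpace.mat, PiLp.inner_apply,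
        matOp_apply, Fin.sum_univ_two]
      simp [a, he, inner_add_left, inner_smul_left, key', inner_self_eq_norm_sq_to_K]
      have hre : RCLike.re (inner 𝕜 (X.toOp x (v 1)) (v 0))
          = RCLike.re (inner 𝕜 (v 0) (X.toOp x (v 1))) := inner_re_symm _ _
      have hb : |RCLike.re (inner 𝕜 (v 0) (X.toOp x (v 1)))| ≤ ‖v 0‖ * (c * ‖v 1‖) :=
        (RCLike.abs_re_le_norm _).trans ((norm_inner_le_norm _ _).trans
          (mul_le_mul_of_nonneg_left ((X.toOp x).le_opNorm _) (norm_nonneg _)))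
      rw [hre]
      nlinarith [(abs_le.mp hb).1, mul_nonneg hc0.le (sq_nonneg (‖v 0‖ - ‖v 1‖))]
  have hq := hT 2 a hpos
  refine ContinuousLinearMap.opNorm_le_bound _ hc0.le fun w => ?_
  set y := Y.toOp (T x) w with hy
  have hq1 := hq.1 (WithLp.toLp 2 ![0, w]) (WithLp.toLp 2 ![y, 0])
  have hq2 := hq.2 (WithLp.toLp 2 ![-y, (c : 𝕜) • w])
  simp only [ContinuousLinearMap.coe_coe, OperatorSpace.mat, PiLp.inner_apply, matOp_apply,
        Fin.sum_univ_two] at hq1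
  simp only [ContinuousLinearMap.reApplyInnerSelf_apply, OperatorSpace.mat, PiLp.inner_apply,
        matOp_apply, Fin.sum_univ_two] at hq2
  simp [a, hTe, ← hy, inner_add_left, inner_smul_left, inner_smul_right] at hq1 hq2
  have hre : RCLike.re (inner 𝕜 (Y.toOp (T x') y) w) = ‖y‖ ^ 2 := by
    rw [inner_re_symm, ← hq1, ← RCLike.ofReal_pow, RCLike.ofReal_re]
  rw [hre] at hq2
  have h3 := nonneg_of_mul_nonneg_right hq2 hc0
  refine abs_le_of_sq_le_sq' ?_ (by positivity) |>.2
  nlinarith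

/-- Group actions on objects of any kind are isometric. -/
theorem GObject.norm_act {k : Kind} {G : Type u} [Group G] (X : GObject k 𝕜 G) (g : G)
    (x : X.space.V) : ‖X.space.toOp (X.act g x)‖ ≤ ‖X.space.toOp x‖ := by
  have hiso : CompletelyIsometric (X := X.space) (Y := X.space) (X.act g) →
      ‖X.space.toOp (X.act g x)‖ ≤ ‖X.space.toOp x‖ := fun h => by
    have h' := h 1 (fun _ _ => x)
    simp only [OperatorSpace.matNorm, OperatorSpace.mat, norm_matOp_one] at h'
    exact h'.le
  obtain ⟨S, hS, ρ, hρ⟩ := X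
  cases k with
  | OSp => exact hiso (hρ g)
  | OSp1 => exact hiso (hρ g).2
  | OSy => exact norm_le_of_completelyPositive hS _ (hρ g).1 (fun n a => ((hρ g).2 n a).1) x

/-- The canonical embedding `j : X → ℓ^∞(G, X)`, `j(x)(s) = s⁻¹ x`. -/
def GObject.j {k : Kind} {G : Type u} [Group G] (X : GObject k 𝕜 G) (x : X.space.V) :
    (ellInf G X.space).V :=
  ⟨fun s => X.act s⁻¹ x, ‖X.space.toOp x‖, fun s => X.norm_act s⁻¹ x⟩

end Embedding

end OpSp

end

noncomputable section

namespace OpSp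

open scoped ENNReal

universe u

/-! ### Bounds for matrices of bilinear forms -/

section FormBound

variable {ι κ : Type} [Fintype ι] [Fintype κ] {B H K : Type*}

/-! If `X` is `G`-injective, the identity of `X` extends along the equivariant embedding `j` to an
equivariant retraction `r` of `ℓ^∞(G, X)` onto `X`, and `j ∘ r` is the required idempotent. The same
argument applied to the inclusion `X ⊆ B(H)` makes `X` a retract of `ℓ^∞(G, B(H))`
(`IsGInjective.exists_retraction`). Plain injectivity follows: for `φ : A → X`, each map `a ↦ s⁻¹
φ(a)` extends to a map into `B(H)` with the bound `‖φ‖_cb`, the extensions are the coordinates of a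
map into `ℓ^∞(G, B(H))`, and `r` brings it back to `X`. No action on `A` or `B` is involved.

Conversely, let `ψ` be a plain extension of an equivariant `η`. The orbit map `b ↦ (s ↦ ψ(s⁻¹ b))`
into `ℓ^∞(G, X)` is equivariant and restricts to `j ∘ η`; the projection `φ` moves it into `j(X)`
without enlarging its cb norm.

The analytic input is the Arveson–Wittstock theorem for maps that are linear over `F₂` only,
`exists_completelyBounded_extension`. A map `φ` into `B(H)` is encoded by the real trilinear form
`Re ⟨h, φ(a) k⟩`, that is, by a functional on `A ⊗ H ⊗ H`. Complete boundedness is domination by a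
gauge: the infimum of `(∑ ‖h i‖² + ∑ ‖k j‖²) / 2` over presentations `∑ b i j ⊗ h i ⊗ k j` with `b`
in the unit ball. The crux is `tensorLift_le_cost`: for tensors over `A`, presentations with
coefficients in `B` give nothing better than those over `A`. Then Hahn–Banach extends the
functional, averaging over imaginary units restores the lost linearity, and the Riesz theorem turns
the form into operators.

The three kinds are treated at once because unital completely positive and unital completely
contractive maps on operator systems coincide (`Kind.isMorphism_iff`), and because an extension of a
unital map along a unital embedding is automatically unital. -/

/-- The matrix of forms `β (a i j)` is bounded by `C`, in the additive formulation. -/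
def FormBound [Norm K] (β : B → K → K → ℝ) (a : Matrix ι κ B) (C : ℝ) : Prop :=
  ∀ (w : ι → K) (v : κ → K),
    ∑ i, ∑ j, β (a i j) (w i) (v j) ≤ C * ((∑ i, ‖w i‖ ^ 2 + ∑ j, ‖v j‖ ^ 2) / 2)

theorem sum_norm_sq_isometry [NormedAddCommGroup H] [InnerProductSpace ℝ H] [DecidableEq κ]
    {V : Matrix ι κ ℝ} (hV : V.transpose * V = 1) (e : κ → H) :
    ∑ i, ‖∑ p, V i p • e p‖ ^ 2 = ∑ p, ‖e p‖ ^ 2 := by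
  have h : ∀ p q, ∑ i, V i p * V i q = if p = q then 1 else 0 := fun p q => by
    have := congrFun (congrFun hV p) q
    simpa [Matrix.mul_apply, Matrix.one_apply] using this
  calc ∑ i, ‖∑ p, V i p • e p‖ ^ 2
      = ∑ i, ∑ p, ∑ q, V i p * V i q * inner ℝ (e p) (e q) := by
        refine Finset.sum_congr rfl fun i _ => ?_
        rw [← real_inner_self_eq_norm_sq, sum_inner]
        refine Finset.sum_congr rfl fun p _ => ?_
        rw [inner_sum]
        refine Finset.sum_congr rfl fun q _ => ?_
        rw [real_inner_smul_left, real_inner_smul_right]; ring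
    _ = ∑ p, ∑ q, (∑ i, V i p * V i q) * inner ℝ (e p) (e q) := by
        rw [Finset.sum_comm]
        refine Finset.sum_congr rfl fun p _ => ?_
        rw [Finset.sum_comm]
        refine Finset.sum_congr rfl fun q _ => ?_
        rw [Finset.sum_mul]
    _ = ∑ p, ‖e p‖ ^ 2 := by
        simp [h]

/-- A finite family in a real inner product space is the image, under an isometric matrix, of a
family possessing a dual family. -/
theorem exists_isometry_dual [NormedAddCommGroup H] [InnerProductSpace ℝ H] (h : ι → H) :
    ∃ (m : ℕ) (V : Matrix ι (Fin m) ℝ) (e x : Fin m → H), V.transpose * V = 1 ∧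
      (∀ i, h i = ∑ p, V i p • e p) ∧ ∀ q p, inner ℝ (x p) (e q) = if p = q then (1 : ℝ) else 0 := by
  -- `L` is the analysis map of the family. An orthonormal basis `o` of its range supplies the
  -- columns of `V`, preimages under `L` supply the dual family `x`, and `e p = ∑ i, o p i • h i`.
  -- Expanding `L y` in this basis gives `h i = ∑ p, V i p • e p`.
  let L : H →ₗ[ℝ] EuclideanSpace ℝ ι :=
    (WithLp.linearEquiv 2 ℝ (ι → ℝ)).symm.toLinearMap ∘ₗ
      LinearMap.pi fun i => (innerSL ℝ (h i)).toLinearMap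
  have hL : ∀ x i, L x i = inner ℝ (h i) x := fun x i => by simp [L]
  let R := LinearMap.range L
  let o := stdOrthonormalBasis ℝ R
  have hx : ∀ p, ∃ x, L x = (o p : EuclideanSpace ℝ ι) := fun p => (o p).2
  choose x hx using hx
  have ho : ∀ p q, ∑ i, (o p : EuclideanSpace ℝ ι) i * (o q : EuclideanSpace ℝ ι) i
      = if p = q then 1 else 0 := fun p q => by
    have := orthonormal_iff_ite.mp o.orthonormal p q
    rw [Submodule.coe_inner, PiLp.inner_apply] at this
    rw [← this]
    refine Finset.sum_congr rfl fun i _ => ?_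
    rw [RCLike.inner_apply, conj_trivial, mul_comm]
  refine ⟨_, Matrix.of fun i p => (o p : EuclideanSpace ℝ ι) i,
    fun p => ∑ i, (o p : EuclideanSpace ℝ ι) i • h i, x, ?_, ?_, ?_⟩
  · ext p q
    rw [Matrix.mul_apply, Matrix.one_apply, ← ho p q]
    rfl
  · intro i
    refine ext_inner_right ℝ fun y => ?_
    have hy := o.sum_repr ⟨L y, y, rfl⟩
    have hy' := congrArg (fun z : R => (z : EuclideanSpace ℝ ι) i) hy
    simp only [Submodule.coe_sum, Submodule.coe_smul, PiLp.smul_apply, WithLp.ofLp_sum,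
      Finset.sum_apply, hL] at hy'
    rw [← hy', sum_inner]
    refine Finset.sum_congr rfl fun p _ => ?_
    rw [real_inner_smul_left, sum_inner, o.repr_apply_apply, Submodule.coe_inner,
      PiLp.inner_apply, smul_eq_mul, mul_comm]
    congr 1
    refine Finset.sum_congr rfl fun l _ => ?_
    rw [real_inner_smul_left, hL]
    simp [mul_comm]
  · intro q p
    rw [inner_sum, ← ho p q]
    refine Finset.sum_congr rfl fun i _ => ?_
    rw [real_inner_smul_right, real_inner_comm, ← hL, hx]; ring

/-- The compression `Vᵀ b W` satisfies the same bound because isometric matrices preserve the sums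
of squared norms of the test vectors. -/
theorem FormBound.compress [AddCommGroup B] [Module ℝ B] [NormedAddCommGroup K] [InnerProductSpace ℝ K]
    {β : B →ₗ[ℝ] K →ₗ[ℝ] K →ₗ[ℝ] ℝ} {ι' κ' : Type} [Fintype ι'] [Fintype κ'] [DecidableEq ι']
    [DecidableEq κ'] {b : Matrix ι κ B} {C : ℝ} (hb : FormBound (fun x y z => β x y z) b C)
    {V : Matrix ι ι' ℝ} {W : Matrix κ κ' ℝ} (hV : V.transpose * V = 1)
    (hW : W.transpose * W = 1) :
    FormBound (fun x y z => β x y z) (fun p q => ∑ i, ∑ j, (V i p * W j q) • b i j) C := by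
  intro w v
  have h := hb (fun i => ∑ p, V i p • w p) (fun j => ∑ q, W j q • v q)
  rw [sum_norm_sq_isometry hV, sum_norm_sq_isometry hW] at h
  refine le_of_eq_of_le ?_ h
  simp only [map_sum, map_smul, LinearMap.sum_apply, LinearMap.smul_apply, smul_eq_mul,
    Finset.mul_sum]
  calc ∑ p, ∑ q, ∑ i, ∑ j, V i p * W j q * β (b i j) (w p) (v q)
      = ∑ p, ∑ i, ∑ q, ∑ j, V i p * W j q * β (b i j) (w p) (v q) :=
        Finset.sum_congr rfl fun _ _ => Finset.sum_comm
    _ = ∑ i, ∑ p, ∑ q, ∑ j, V i p * W j q * β (b i j) (w p) (v q) := Finset.sum_comm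
    _ = ∑ i, ∑ p, ∑ j, ∑ q, V i p * W j q * β (b i j) (w p) (v q) :=
        Finset.sum_congr rfl fun _ _ => Finset.sum_congr rfl fun _ _ => Finset.sum_comm
    _ = ∑ i, ∑ j, ∑ p, ∑ q, V i p * W j q * β (b i j) (w p) (v q) :=
        Finset.sum_congr rfl fun _ _ => Finset.sum_comm
    _ = _ := by
        refine Finset.sum_congr rfl fun i _ => Finset.sum_congr rfl fun j _ => ?_
        rw [Finset.sum_comm]
        refine Finset.sum_congr rfl fun p _ => Finset.sum_congr rfl fun q _ => ?_
        ring

/-- The additive right-hand side splits over the two blocks, so the bound of a direct sum is not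
doubled. This is what makes the gauge subadditive. -/
theorem FormBound.fromBlocks_diag [Zero B] [SeminormedAddCommGroup K] {β : B → K → K → ℝ}
    (hβ : ∀ x y, β 0 x y = 0)
    {ι' κ' : Type} [Fintype ι'] [Fintype κ'] {b : Matrix ι κ B} {b' : Matrix ι' κ' B} {C : ℝ}
    (hb : FormBound β b C) (hb' : FormBound β b' C) :
    FormBound β (Matrix.fromBlocks b 0 0 b') C := by
  intro w v
  have h := hb (fun i => w (Sum.inl i)) (fun i => v (Sum.inl i))
  have h' := hb' (fun i => w (Sum.inr i)) (fun i => v (Sum.inr i))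
  simp only [Fintype.sum_sum_type, Matrix.fromBlocks_apply₁₁, Matrix.fromBlocks_apply₁₂,
    Matrix.fromBlocks_apply₂₁, Matrix.fromBlocks_apply₂₂, Matrix.zero_apply, hβ,
    Finset.sum_const_zero, add_zero, zero_add]
  linarith

end FormBound

/-! ### The Hahn–Banach extension of dominated trilinear forms -/

section Extension

open scoped TensorProduct

variable {A B H K : Type*} [AddCommGroup A] [Module ℝ A] [AddCommGroup B] [Module ℝ B]
  [NormedAddCommGroup H] [InnerProductSpace ℝ H] [NormedAddCommGroup K] [InnerProductSpace ℝ K]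

/-- The element `∑ b i j ⊗ (h i ⊗ k j)`. -/
def tensorSum {ι κ : Type} [Fintype ι] [Fintype κ] (b : Matrix ι κ B) (h : ι → H) (k : κ → H) :
    B ⊗[ℝ] (H ⊗[ℝ] H) := ∑ i, ∑ j, b i j ⊗ₜ (h i ⊗ₜ k j)

/-- The costs of the presentations of `z` through matrices bounded by one. -/
def costs (β : B →ₗ[ℝ] K →ₗ[ℝ] K →ₗ[ℝ] ℝ) (z : B ⊗[ℝ] (H ⊗[ℝ] H)) : Set ℝ :=
  {t | ∃ (ι κ : Type) (_ : Fintype ι) (_ : Fintype κ) (b : Matrix ι κ B) (h : ι → H) (k : κ → H),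
    FormBound (fun x y z => β x y z) b 1 ∧ z = tensorSum b h k ∧
      t = (∑ i, ‖h i‖ ^ 2 + ∑ j, ‖k j‖ ^ 2) / 2}

variable (β : B →ₗ[ℝ] K →ₗ[ℝ] K →ₗ[ℝ] ℝ)

theorem costs_bddBelow (z : B ⊗[ℝ] (H ⊗[ℝ] H)) : BddBelow (costs β z) := by
  refine ⟨0, ?_⟩
  rintro t ⟨ι, κ, _, _, b, h, k, -, -, rfl⟩
  positivity

theorem add_mem_costs {z z' : B ⊗[ℝ] (H ⊗[ℝ] H)} {t t' : ℝ} (ht : t ∈ costs β z)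
    (ht' : t' ∈ costs β z') : t + t' ∈ costs β (z + z') := by
  obtain ⟨ι, κ, _, _, b, h, k, hb, rfl, rfl⟩ := ht
  obtain ⟨ι', κ', _, _, b', h', k', hb', rfl, rfl⟩ := ht'
  refine ⟨ι ⊕ ι', κ ⊕ κ', inferInstance, inferInstance, Matrix.fromBlocks b 0 0 b',
    Sum.elim h h', Sum.elim k k', hb.fromBlocks_diag (by simp) hb', ?_, ?_⟩
  · simp [tensorSum, Fintype.sum_sum_type]
  · simp [Fintype.sum_sum_type]; ring

theorem smul_mem_costs {z : B ⊗[ℝ] (H ⊗[ℝ] H)} {t c : ℝ} (hc : 0 ≤ c) (ht : t ∈ costs β z) :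
    c * t ∈ costs β (c • z) := by
  obtain ⟨ι, κ, _, _, b, h, k, hb, rfl, rfl⟩ := ht
  -- The cost is quadratic in the vectors, and the tensor is linear in each of the two legs, so each
  -- leg takes a factor `√c`.
  refine ⟨ι, κ, inferInstance, inferInstance, b, fun i => √c • h i, fun j => √c • k j, hb, ?_, ?_⟩
  · simp only [tensorSum, Finset.smul_sum, ← TensorProduct.smul_tmul', TensorProduct.tmul_smul,
      smul_smul, Real.mul_self_sqrt hc]
  · simp only [norm_smul, mul_pow, Real.norm_eq_abs, sq_abs, Real.sq_sqrt hc, ← Finset.mul_sum]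
    ring

/-- Finiteness of the gauge: in an elementary tensor the size of the coefficient is moved to a
vector leg, and sums are handled by `add_mem_costs`. -/
theorem costs_nonempty (hβ : ∀ b, ∃ C : ℝ, ∀ w v, β b w v ≤ C * (‖w‖ * ‖v‖))
    (z : B ⊗[ℝ] (H ⊗[ℝ] H)) : (costs β z).Nonempty := by
  have key : ∀ (b : B) (h k : H), (costs β (b ⊗ₜ[ℝ] (h ⊗ₜ[ℝ] k))).Nonempty := fun b h k => by
    obtain ⟨C, hC⟩ := hβ b
    set D := max C 1 with hD
    have hD0 : 0 < D := lt_of_lt_of_le one_pos (le_max_right _ _)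
    refine ⟨_, Unit, Unit, inferInstance, inferInstance, fun _ _ => D⁻¹ • b, fun _ => D • h,
      fun _ => k, ?_, ?_, rfl⟩
    · intro w v
      simp only [Finset.univ_unique, Finset.sum_singleton, map_smul, LinearMap.smul_apply,
        smul_eq_mul]
      have h1 : β b (w default) (v default) ≤ D * (‖w default‖ * ‖v default‖) :=
        (hC _ _).trans (mul_le_mul_of_nonneg_right (le_max_left _ _) (by positivity))
      have h2 : D⁻¹ * β b (w default) (v default) ≤ ‖w default‖ * ‖v default‖ := by
        rw [inv_mul_le_iff₀ hD0]; exact h1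
      nlinarith [sq_nonneg (‖w default‖ - ‖v default‖)]
    · simp [tensorSum, ← TensorProduct.smul_tmul', TensorProduct.tmul_smul, smul_smul, hD0.ne']
  induction z using TensorProduct.induction_on with
  | zero =>
    refine ⟨_, Empty, Empty, inferInstance, inferInstance, 0, isEmptyElim, isEmptyElim, ?_, ?_, rfl⟩
    · intro w v; simp
    · simp [tensorSum]
  | tmul b y =>
    induction y using TensorProduct.induction_on with
    | zero => simpa using key b 0 0
    | tmul h k => exact key b h k
    | add x y hx hy =>
      rw [TensorProduct.tmul_add]
      exact ⟨_, add_mem_costs β hx.some_mem hy.some_mem⟩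
  | add x y hx hy => exact ⟨_, add_mem_costs β hx.some_mem hy.some_mem⟩

/-- The functional on the tensor product given by a trilinear form. -/
def tensorLift (φ : A →ₗ[ℝ] H →ₗ[ℝ] H →ₗ[ℝ] ℝ) : A ⊗[ℝ] (H ⊗[ℝ] H) →ₗ[ℝ] ℝ :=
  TensorProduct.lift ((TensorProduct.lift.equiv (RingHom.id ℝ) H H ℝ).toLinearMap ∘ₗ φ)

theorem tensorLift_tmul (φ : A →ₗ[ℝ] H →ₗ[ℝ] H →ₗ[ℝ] ℝ) (a : A) (h k : H) :
    tensorLift φ (a ⊗ₜ (h ⊗ₜ k)) = φ a h k := by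
  simp [tensorLift]

/-- Evaluation of the two vector legs against `x` and `y`. -/
def slice (x y : H) : A ⊗[ℝ] (H ⊗[ℝ] H) →ₗ[ℝ] A :=
  (TensorProduct.rid ℝ A).toLinearMap ∘ₗ LinearMap.lTensor A
    ((TensorProduct.rid ℝ ℝ).toLinearMap ∘ₗ
      TensorProduct.map (innerSL ℝ x).toLinearMap (innerSL ℝ y).toLinearMap)

theorem slice_tmul (x y : H) (a : A) (h k : H) :
    slice x y (a ⊗ₜ (h ⊗ₜ k)) = (inner ℝ x h * inner ℝ y k) • a := by
  simp [slice, mul_comm]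

theorem slice_rTensor (κ : A →ₗ[ℝ] B) (x y : H) (z : A ⊗[ℝ] (H ⊗[ℝ] H)) :
    slice x y (LinearMap.rTensor (H ⊗[ℝ] H) κ z) = κ (slice x y z) := by
  rw [← LinearMap.comp_apply, ← LinearMap.comp_apply]
  congr 1
  ext a h k
  simp [slice_tmul]

/-- A trilinear form dominated on the tensors over `A` is dominated on those tensors by the
costs computed over `B`. -/
theorem tensorLift_le_cost {κ : A →ₗ[ℝ] B} (hκ : Function.Injective κ)
    {φ : A →ₗ[ℝ] H →ₗ[ℝ] H →ₗ[ℝ] ℝ} {c : ℝ}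
    (hφ : ∀ (ι ι' : Type) [Fintype ι] [Fintype ι'] (a : Matrix ι ι' A),
      FormBound (fun x y z => β x y z) (a.map κ) 1 → FormBound (fun x y z => φ x y z) a c)
    {z : A ⊗[ℝ] (H ⊗[ℝ] H)} {t : ℝ} (ht : t ∈ costs β (LinearMap.rTensor (H ⊗[ℝ] H) κ z)) :
    tensorLift φ z ≤ c * t := by
  obtain ⟨ι, ι', _, _, b, h, k, hb, hz, rfl⟩ := ht
  -- Both legs are replaced by families with dual families. The isometric matrices go into the
  -- coefficients, which keeps the coefficient bound and the cost unchanged.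
  obtain ⟨m, V, e, x, hV, hh, hx⟩ := exists_isometry_dual h
  obtain ⟨n, W, f, y, hW, hk, hy⟩ := exists_isometry_dual k
  let b' : Matrix (Fin m) (Fin n) B := fun p q => ∑ i, ∑ j, (V i p * W j q) • b i j
  have hb' : FormBound (fun x y z => β x y z) b' 1 := hb.compress hV hW
  have hz' : LinearMap.rTensor (H ⊗[ℝ] H) κ z = tensorSum b' e f := by
    rw [hz]
    simp only [tensorSum, b', hh, hk, TensorProduct.tmul_sum, TensorProduct.sum_tmul,
      TensorProduct.tmul_smul, ← TensorProduct.smul_tmul', Finset.smul_sum, smul_smul]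
    calc ∑ i, ∑ j, ∑ q, ∑ p, (W j q * V i p) • b i j ⊗ₜ[ℝ] (e p ⊗ₜ[ℝ] f q)
        = ∑ i, ∑ q, ∑ j, ∑ p, (W j q * V i p) • b i j ⊗ₜ[ℝ] (e p ⊗ₜ[ℝ] f q) :=
          Finset.sum_congr rfl fun _ _ => Finset.sum_comm
      _ = ∑ q, ∑ i, ∑ j, ∑ p, (W j q * V i p) • b i j ⊗ₜ[ℝ] (e p ⊗ₜ[ℝ] f q) := Finset.sum_comm
      _ = ∑ q, ∑ i, ∑ p, ∑ j, (W j q * V i p) • b i j ⊗ₜ[ℝ] (e p ⊗ₜ[ℝ] f q) :=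
          Finset.sum_congr rfl fun _ _ => Finset.sum_congr rfl fun _ _ => Finset.sum_comm
      _ = ∑ q, ∑ p, ∑ i, ∑ j, (W j q * V i p) • b i j ⊗ₜ[ℝ] (e p ⊗ₜ[ℝ] f q) :=
          Finset.sum_congr rfl fun _ _ => Finset.sum_comm
      _ = ∑ p, ∑ q, ∑ i, ∑ j, (W j q * V i p) • b i j ⊗ₜ[ℝ] (e p ⊗ₜ[ℝ] f q) := Finset.sum_comm
      _ = _ := by simp only [mul_comm]
  -- Slicing against the dual families reads off the coefficients of the presentation. Since slicing
  -- commutes with `κ`, the coefficients `b'` come from `A`.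
  let a : Matrix (Fin m) (Fin n) A := fun p q => slice (x p) (y q) z
  have ha : a.map κ = b' := by
    ext p q
    rw [Matrix.map_apply, ← slice_rTensor, hz']
    simp [tensorSum, slice_tmul, hx, hy]
  have hza : z = tensorSum a e f := by
    -- The presentation has only been verified after applying `κ`; flatness over `ℝ` lifts it back
    -- to `A`.
    apply Module.Flat.rTensor_preserves_injective_linearMap (M := H ⊗[ℝ] H) κ hκ
    rw [hz', ← ha]
    simp [tensorSum]
  have hfin := hφ _ _ a (by rw [ha]; exact hb') e f
  rw [hza, ← sum_norm_sq_isometry hV e, ← sum_norm_sq_isometry hW f] at *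
  simp only [← hh, ← hk] at hfin
  simpa [tensorSum, tensorLift_tmul] using hfin

/-- Extension of dominated trilinear forms along an injective map. -/
theorem exists_trilinear_extension (hβ : ∀ b, ∃ C : ℝ, ∀ w v, β b w v ≤ C * (‖w‖ * ‖v‖))
    {κ : A →ₗ[ℝ] B} (hκ : Function.Injective κ)
    {φ : A →ₗ[ℝ] H →ₗ[ℝ] H →ₗ[ℝ] ℝ} {c : ℝ} (hc : 0 ≤ c)
    (hφ : ∀ (ι ι' : Type) [Fintype ι] [Fintype ι'] (a : Matrix ι ι' A),
      FormBound (fun x y z => β x y z) (a.map κ) 1 → FormBound (fun x y z => φ x y z) a c) :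
    ∃ g : B →ₗ[ℝ] H →ₗ[ℝ] H →ₗ[ℝ] ℝ, (∀ a, g (κ a) = φ a) ∧
      ∀ (ι ι' : Type) [Fintype ι] [Fintype ι'] (b : Matrix ι ι' B),
        FormBound (fun x y z => β x y z) b 1 → FormBound (fun x y z => g x y z) b c := by
  have hinj := Module.Flat.rTensor_preserves_injective_linearMap (M := H ⊗[ℝ] H) κ hκ
  -- The sublinear functional for Hahn–Banach: `c` times the gauge.
  let N : B ⊗[ℝ] (H ⊗[ℝ] H) → ℝ := fun z => c * sInf (costs β z)
  have hne := costs_nonempty (H := H) β hβ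
  have hsm : ∀ r : ℝ, 0 < r → ∀ z : B ⊗[ℝ] (H ⊗[ℝ] H),
      sInf (costs β (r • z)) ≤ r * sInf (costs β z) := fun r hr z => by
    rw [← div_le_iff₀' hr]
    refine le_csInf (hne z) fun t ht => ?_
    rw [div_le_iff₀' hr]
    exact csInf_le (costs_bddBelow β _) (smul_mem_costs β hr.le ht)
  let f : (B ⊗[ℝ] (H ⊗[ℝ] H)) →ₗ.[ℝ] ℝ :=
    { domain := LinearMap.range (LinearMap.rTensor (H ⊗[ℝ] H) κ)
      toFun := tensorLift φ ∘ₗ (LinearEquiv.ofInjective _ hinj).symm.toLinearMap }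
  obtain ⟨g, hg, hgN⟩ := exists_extension_of_le_sublinear f N
    (fun r hr z => by
      have h1 := hsm r hr z
      have h2 := hsm r⁻¹ (inv_pos.mpr hr) (r • z)
      rw [smul_smul, inv_mul_cancel₀ hr.ne', one_smul, le_inv_mul_iff₀ hr] at h2
      simp only [N]
      rw [le_antisymm h1 h2]; ring)
    (fun z z' => by
      simp only [N]
      rw [← mul_add]
      refine mul_le_mul_of_nonneg_left ?_ hc
      refine le_of_forall_pos_le_add fun ε hε => ?_
      obtain ⟨t, ht, hlt⟩ := Real.lt_sInf_add_pos (hne z) (half_pos hε)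
      obtain ⟨t', ht', hlt'⟩ := Real.lt_sInf_add_pos (hne z') (half_pos hε)
      have := csInf_le (costs_bddBelow β _) (add_mem_costs β ht ht')
      linarith)
    (by
      rintro ⟨_, z, rfl⟩
      have hf : f ⟨_, z, rfl⟩ = tensorLift φ z := by
        change tensorLift φ ((LinearEquiv.ofInjective _ hinj).symm _) = _
        congr 1
        rw [LinearEquiv.symm_apply_eq]
        rfl
      rw [hf]
      simp only [N]
      rcases hc.eq_or_lt with rfl | hc'
      · obtain ⟨t, ht⟩ := hne (LinearMap.rTensor (H ⊗[ℝ] H) κ z)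
        simpa using tensorLift_le_cost β hκ hφ ht
      · rw [← div_le_iff₀' hc']
        refine le_csInf (hne _) fun t ht => ?_
        rw [div_le_iff₀' hc']
        exact tensorLift_le_cost β hκ hφ ht)
  let g' : B →ₗ[ℝ] H →ₗ[ℝ] H →ₗ[ℝ] ℝ :=
    (TensorProduct.lift.equiv (RingHom.id ℝ) H H ℝ).symm.toLinearMap ∘ₗ TensorProduct.curry g
  have hg' : ∀ b h k, g' b h k = g (b ⊗ₜ (h ⊗ₜ k)) := fun b h k => by simp [g']
  refine ⟨g', fun a => ?_, fun ι ι' _ _ b hb h k => ?_⟩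
  · ext h k
    have h1 := hg ⟨_, a ⊗ₜ (h ⊗ₜ k), rfl⟩
    have hf : f ⟨_, a ⊗ₜ (h ⊗ₜ k), rfl⟩ = tensorLift φ (a ⊗ₜ (h ⊗ₜ k)) := by
      change tensorLift φ ((LinearEquiv.ofInjective _ hinj).symm _) = _
      congr 1
      rw [LinearEquiv.symm_apply_eq]
      rfl
    rw [hf, tensorLift_tmul] at h1
    rw [hg', ← h1]
    simp
  · have h1 := hgN (tensorSum b h k)
    have h2 : N (tensorSum b h k) ≤ _ := mul_le_mul_of_nonneg_left
      (csInf_le (costs_bddBelow β _) ⟨ι, ι', _, _, b, h, k, hb, rfl, rfl⟩) hc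
    refine le_trans (le_of_eq ?_) (h1.trans h2)
    simp [hg', tensorSum]

end Extension

/-! ### Matrix norms and positivity through real forms -/

section Forms

open RCLike

variable {𝕜 : Type} [RCLike 𝕜] {X Y : OperatorSpace.{u} 𝕜}

/-- The real bilinear form `Re ⟨w, x v⟩` of an element of an operator space. -/
def OperatorSpace.form (X : OperatorSpace.{u} 𝕜) (x : X.V) (w v : X.H) : ℝ :=
  re (inner 𝕜 w (X.toOp x v))

namespace OperatorSpace

theorem form_add (x y : X.V) (w v : X.H) : X.form (x + y) w v = X.form x w v + X.form y w v := by
  simp [form, inner_add_right]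

theorem form_smul (r : ℝ) (x : X.V) (w v : X.H) :
    X.form ((r : 𝕜) • x) w v = r * X.form x w v := by
  simp [form, inner_smul_right]

@[simp] theorem form_zero (w v : X.H) : X.form 0 w v = 0 := by simp [form]

@[simp] theorem form_zero_left (x : X.V) (v : X.H) : X.form x 0 v = 0 := by simp [form]

@[simp] theorem form_zero_right (x : X.V) (w : X.H) : X.form x w 0 = 0 := by simp [form]

theorem form_neg_left (x : X.V) (w v : X.H) : X.form x (-w) v = -X.form x w v := by
  simp [form]

theorem form_neg_right (x : X.V) (w v : X.H) : X.form x w (-v) = -X.form x w v := by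
  simp [form]

theorem form_unit {e : X.V} (he : X.toOp e = 1) (w v : X.H) :
    X.form e w v = re (inner 𝕜 w v) := by
  simp [form, he]

theorem form_le (x : X.V) (w v : X.H) : X.form x w v ≤ ‖X.toOp x‖ * (‖w‖ * ‖v‖) :=
  (re_le_norm _).trans <| (norm_inner_le_norm _ _).trans <| by
    calc ‖w‖ * ‖X.toOp x v‖ ≤ ‖w‖ * (‖X.toOp x‖ * ‖v‖) :=
          mul_le_mul_of_nonneg_left ((X.toOp x).le_opNorm v) (norm_nonneg _)
      _ = _ := by ring

theorem re_inner_mat {n : ℕ} (a : Matrix (Fin n) (Fin n) X.V) (w v : PiLp 2 fun _ : Fin n => X.H) :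
    re (inner 𝕜 w (X.mat a v)) = ∑ i, ∑ j, X.form (a i j) (w i) (v j) := by
  simp [PiLp.inner_apply, mat, matOp_apply, inner_sum, form]

theorem sum_form_diagonal {ι : Type} [Fintype ι] [DecidableEq ι] (x : X.V) (w v : ι → X.H) :
    ∑ i, ∑ j, X.form (Matrix.diagonal (fun _ => x) i j) (w i) (v j)
      = ∑ i, X.form x (w i) (v i) := by
  refine Finset.sum_congr rfl fun i _ => ?_
  rw [Finset.sum_eq_single i]
  · simp
  · intro j _ hj
    rw [Matrix.diagonal_apply_ne _ hj.symm, form_zero]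
  · simp

end OperatorSpace

open OperatorSpace

theorem opNorm_le_iff_re_inner {K : Type*} [NormedAddCommGroup K] [InnerProductSpace 𝕜 K]
    (S : K →L[𝕜] K) {C : ℝ} (hC : 0 ≤ C) :
    ‖S‖ ≤ C ↔ ∀ w v, re (inner 𝕜 w (S v)) ≤ C * ((‖w‖ ^ 2 + ‖v‖ ^ 2) / 2) := by
  constructor
  · intro h w v
    have h1 : re (inner 𝕜 w (S v)) ≤ ‖w‖ * ‖S v‖ := (re_le_norm _).trans (norm_inner_le_norm _ _)
    have h2 : ‖S v‖ ≤ C * ‖v‖ :=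
      (S.le_opNorm v).trans (mul_le_mul_of_nonneg_right h (norm_nonneg _))
    have h3 := mul_le_mul_of_nonneg_left h2 (norm_nonneg w)
    nlinarith [mul_nonneg hC (sq_nonneg (‖w‖ - ‖v‖))]
  · intro h
    refine ContinuousLinearMap.opNorm_le_bound _ hC fun v => ?_
    rcases (norm_nonneg v).eq_or_lt with hv | hv
    · rw [eq_comm, norm_eq_zero] at hv
      simp [hv]
    rcases (norm_nonneg (S v)).eq_or_lt with hu | hu
    · rw [← hu]; positivity
    -- The test vectors are rescaled to equal norms `‖v‖ ‖S v‖`, where the arithmetic-geometric mean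
    -- inequality loses nothing.
    have h1 := h ((‖v‖ : 𝕜) • S v) ((‖S v‖ : 𝕜) • v)
    rw [map_smul, inner_smul_left, inner_smul_right, inner_self_eq_norm_sq_to_K, conj_ofReal,
      norm_smul, norm_smul, norm_ofReal, norm_ofReal, abs_of_pos hv, abs_of_pos hu,
      ← ofReal_pow, ← ofReal_mul, ← ofReal_mul, ofReal_re] at h1
    have h2 : ‖v‖ * ‖S v‖ ^ 2 * (‖S v‖ - C * ‖v‖) ≤ 0 := by nlinarith
    have h3 : 0 < ‖v‖ * ‖S v‖ ^ 2 := by positivity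
    nlinarith [nonpos_of_mul_nonpos_right h2 h3]

theorem matNorm_le_iff {n : ℕ} (a : Matrix (Fin n) (Fin n) X.V) {C : ℝ} (hC : 0 ≤ C) :
    X.matNorm a ≤ C ↔ FormBound X.form a C := by
  rw [OperatorSpace.matNorm, opNorm_le_iff_re_inner _ hC]
  constructor
  · intro h w v
    have := h (WithLp.toLp 2 w) (WithLp.toLp 2 v)
    rwa [re_inner_mat, PiLp.norm_sq_eq_of_L2, PiLp.norm_sq_eq_of_L2] at this
  · intro h w v
    rw [re_inner_mat, PiLp.norm_sq_eq_of_L2, PiLp.norm_sq_eq_of_L2]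
    exact h w v

theorem matNorm_nonneg {n : ℕ} (a : Matrix (Fin n) (Fin n) X.V) : 0 ≤ X.matNorm a := norm_nonneg _

theorem FormBound.submatrix_equiv {B K : Type*} [Norm K] {β : B → K → K → ℝ}
    {ι κ ι' κ' : Type} [Fintype ι] [Fintype κ] [Fintype ι'] [Fintype κ'] {a : Matrix ι κ B} {C : ℝ}
    (h : FormBound β a C) (e : ι' ≃ ι) (f : κ' ≃ κ) : FormBound β (a.submatrix e f) C := by
  intro w v
  have := h (w ∘ e.symm) (v ∘ f.symm)
  rw [← e.sum_comp, ← e.sum_comp (fun i => ‖(w ∘ e.symm) i‖ ^ 2),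
    ← f.sum_comp (fun i => ‖(v ∘ f.symm) i‖ ^ 2)] at this
  simp only [← f.sum_comp (fun j => β (a _ j) _ _)] at this
  simpa using this

/-- The amplifications of `T` are bounded by `c`. -/
def CompletelyBoundedBy (T : X.V → Y.V) (c : ℝ) : Prop :=
  ∀ (n : ℕ) (a : Matrix (Fin n) (Fin n) X.V), Y.matNorm (a.map T) ≤ c * X.matNorm a

theorem completelyBoundedBy_one_iff {T : X.V → Y.V} :
    CompletelyBoundedBy T 1 ↔ CompletelyContractive T := by
  simp [CompletelyBoundedBy, CompletelyContractive]

theorem CompletelyBoundedBy.of_formBound {T : X.V → Y.V} {c : ℝ} (hc : 0 ≤ c)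
    (h : ∀ (n : ℕ) (a : Matrix (Fin n) (Fin n) X.V) (C : ℝ), 0 ≤ C → FormBound X.form a C →
      FormBound Y.form (a.map T) (c * C)) : CompletelyBoundedBy T c := fun n a =>
  (matNorm_le_iff _ (mul_nonneg hc (matNorm_nonneg a))).2
    (h n a _ (matNorm_nonneg a) ((matNorm_le_iff a (matNorm_nonneg a)).1 le_rfl))

/-- A rectangular matrix becomes a corner of a square one of size `ι ⊕ κ`. The two maps `S` and `T`
on a common domain also cover the inverse of a complete isometry, with `T = id`. -/
theorem formBound_of_matNorm_le {V : Type*} [Zero V] {S : V → X.V} {T : V → Y.V} {c : ℝ}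
    (hc : 0 ≤ c) (hS : S 0 = 0) (hT : T 0 = 0)
    (h : ∀ (n : ℕ) (a : Matrix (Fin n) (Fin n) V), Y.matNorm (a.map T) ≤ c * X.matNorm (a.map S))
    {ι κ : Type} [Fintype ι] [Fintype κ] {a : Matrix ι κ V} {C : ℝ} (hC : 0 ≤ C)
    (ha : FormBound X.form (a.map S) C) : FormBound Y.form (a.map T) (c * C) := by
  let A : Matrix (ι ⊕ κ) (ι ⊕ κ) V := Matrix.fromBlocks 0 a 0 0
  have hA : FormBound X.form (A.map S) C := by
    intro w v
    have h1 := ha (fun i => w (Sum.inl i)) (fun j => v (Sum.inr j))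
    simp only [A, Fintype.sum_sum_type, Matrix.map_apply, Matrix.fromBlocks_apply₁₁,
      Matrix.fromBlocks_apply₁₂, Matrix.fromBlocks_apply₂₁, Matrix.fromBlocks_apply₂₂,
      Matrix.zero_apply, hS, form_zero, Finset.sum_const_zero, add_zero, zero_add]
    refine h1.trans (mul_le_mul_of_nonneg_left ?_ hC)
    have h2 : 0 ≤ ∑ j, ‖w (Sum.inr j)‖ ^ 2 := by positivity
    have h3 : 0 ≤ ∑ i, ‖v (Sum.inl i)‖ ^ 2 := by positivity
    linarith
  let e := Fintype.equivFin (ι ⊕ κ)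
  have h1 := hA.submatrix_equiv e.symm e.symm
  have h2 := (h _ (A.submatrix e.symm e.symm)).trans
    (mul_le_mul_of_nonneg_left ((matNorm_le_iff _ hC).2 h1) hc)
  rw [matNorm_le_iff _ (mul_nonneg hc hC)] at h2
  have h3 := h2.submatrix_equiv e e
  intro w v
  have h4 := h3 (Sum.elim w 0) (Sum.elim 0 v)
  simpa [A, Fintype.sum_sum_type, hT] using h4

theorem CompletelyBoundedBy.formBound {T : X.V → Y.V} {c : ℝ} (hc : 0 ≤ c) (hT : T 0 = 0)
    (h : CompletelyBoundedBy T c) {ι κ : Type} [Fintype ι] [Fintype κ] {a : Matrix ι κ X.V}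
    {C : ℝ} (hC : 0 ≤ C) (ha : FormBound X.form a C) : FormBound Y.form (a.map T) (c * C) :=
  formBound_of_matNorm_le (S := id) hc rfl hT (fun n a => by simpa using h n a) hC
    (by simpa using ha)

/-! ### Completely positive and completely contractive unital maps -/

/-- Positivity of a square matrix over an operator space in terms of the real forms. -/
def FormPos (X : OperatorSpace.{u} 𝕜) {ι : Type} [Fintype ι] (a : Matrix ι ι X.V) : Prop :=
  (∀ w v : ι → X.H, ∑ i, ∑ j, X.form (a i j) (w i) (v j) = ∑ i, ∑ j, X.form (a i j) (v i) (w j)) ∧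
    ∀ v : ι → X.H, 0 ≤ ∑ i, ∑ j, X.form (a i j) (v i) (v j)

/-- The imaginary part of an inner product is recovered from real parts by replacing `w` with `I •
w`; over a real field it vanishes. -/
theorem isSymmetric_of_re_inner {K : Type*} [NormedAddCommGroup K] [InnerProductSpace 𝕜 K]
    (S : K →L[𝕜] K) (h : ∀ w v, re (inner 𝕜 w (S v)) = re (inner 𝕜 v (S w))) :
    (S : K →ₗ[𝕜] K).IsSymmetric := by
  have h' : ∀ w v, re (inner 𝕜 (S w) v) = re (inner 𝕜 w (S v)) := fun w v => by
    rw [inner_re_symm, h]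
  intro w v
  refine RCLike.ext (h' w v) ?_
  rcases I_mul_I (K := 𝕜) with hI | hI
  · have : ∀ z : 𝕜, im z = 0 := fun z => by
      rw [← RCLike.I_im z, hI, map_zero, mul_zero]
    rw [this, this]
  · have h1 := h' ((I : 𝕜) • w) v
    have h2 : im (I : 𝕜) = 1 := (I_eq_zero_or_im_I_eq_one (K := 𝕜)).resolve_left fun h0 => by
      simp [h0] at hI
    rw [map_smul, inner_smul_left, inner_smul_left] at h1
    simpa [h2] using h1

theorem matPos_iff {n : ℕ} (a : Matrix (Fin n) (Fin n) X.V) : X.MatPos a ↔ FormPos X a := by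
  constructor
  · intro h
    refine ⟨fun w v => ?_, fun v => ?_⟩
    · have := congrArg (re (K := 𝕜)) (h.1 (WithLp.toLp 2 v) (WithLp.toLp 2 w))
      rw [ContinuousLinearMap.coe_coe, inner_re_symm, re_inner_mat, re_inner_mat] at this
      exact this
    · have := h.2 (WithLp.toLp 2 v)
      rw [ContinuousLinearMap.reApplyInnerSelf_apply, inner_re_symm, re_inner_mat] at this
      exact this
  · intro h
    refine ⟨isSymmetric_of_re_inner (X.mat a) fun w v => ?_, fun v => ?_⟩
    · rw [re_inner_mat, re_inner_mat]
      exact h.1 w v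
    · rw [ContinuousLinearMap.reApplyInnerSelf_apply, inner_re_symm, re_inner_mat]
      exact h.2 v

theorem FormPos.submatrix_equiv {ι ι' : Type} [Fintype ι] [Fintype ι'] {a : Matrix ι ι X.V}
    (h : FormPos X a) (e : ι' ≃ ι) : FormPos X (a.submatrix e e) := by
  have key : ∀ w v : ι' → X.H, ∑ i, ∑ j, X.form (a.submatrix e e i j) (w i) (v j)
      = ∑ i, ∑ j, X.form (a i j) (w (e.symm i)) (v (e.symm j)) := fun w v => by
    rw [← e.sum_comp]
    simp only [← e.sum_comp (fun j => X.form (a _ j) _ _)]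
    simp
  refine ⟨fun w v => ?_, fun v => ?_⟩
  · rw [key, key]; exact h.1 _ _
  · rw [key]; exact h.2 _

theorem CompletelyPositive.formPos {T : X.V → Y.V} (hT : CompletelyPositive T) {ι : Type}
    [Fintype ι] {a : Matrix ι ι X.V} (h : FormPos X a) : FormPos Y (a.map T) := by
  let e := Fintype.equivFin ι
  have h1 := (matPos_iff _).1 (hT _ _ ((matPos_iff _).2 (h.submatrix_equiv e.symm)))
  have h2 := h1.submatrix_equiv e
  have : ((a.submatrix e.symm e.symm).map T).submatrix e e = a.map T := by
    ext i j; simp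
  rwa [this] at h2

/-- Unital completely positive real-linear maps on operator systems are completely contractive. -/
theorem CompletelyPositive.completelyContractive (hX : X.IsSystem) {T : X.V → Y.V}
    (hsmul : ∀ (r : ℝ) x, T ((r : 𝕜) • x) = (r : 𝕜) • T x) (h1 : MapsUnit T)
    (hT : CompletelyPositive T) : CompletelyContractive T := by
  obtain ⟨⟨e, he⟩, hs⟩ := hX
  have hT0 : T 0 = 0 := by simpa using hsmul 0 0
  have hTe := h1 e he
  choose s hs using hs
  have hsf : ∀ x w v, X.form (s x) w v = X.form x v w := fun x w v => by
    rw [form, hs, ContinuousLinearMap.star_eq_adjoint, ContinuousLinearMap.adjoint_inner_right,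
      inner_re_symm, form]
  rw [← completelyBoundedBy_one_iff]
  refine .of_formBound zero_le_one fun n a C hC ha => ?_
  rw [one_mul]
  -- The block matrix with diagonal `C` and off-diagonal entries `a` and `a*` is positive as soon as
  -- `‖a‖ ≤ C`.
  let A : Matrix (Fin n ⊕ Fin n) (Fin n ⊕ Fin n) X.V :=
    Matrix.fromBlocks (Matrix.diagonal fun _ => (C : 𝕜) • e) a (Matrix.of fun i j => s (a j i))
      (Matrix.diagonal fun _ => (C : 𝕜) • e)
  have hA : FormPos X A := by
    constructor
    · intro w v
      simp only [A, Fintype.sum_sum_type, Matrix.fromBlocks_apply₁₁, Matrix.fromBlocks_apply₁₂,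
        Matrix.fromBlocks_apply₂₁, Matrix.fromBlocks_apply₂₂, Matrix.of_apply, hsf, sum_form_diagonal,
        Finset.sum_add_distrib, form_smul, form_unit he]
      rw [Finset.sum_comm (f := fun i j => X.form (a j i) (v (Sum.inl j)) (w (Sum.inr i))),
        Finset.sum_comm (f := fun i j => X.form (a j i) (w (Sum.inl j)) (v (Sum.inr i)))]
      simp only [inner_re_symm (𝕜 := 𝕜) (w _) (v _)]
      ring
    · intro v
      have h2 := ha (fun i => -v (Sum.inl i)) (fun i => v (Sum.inr i))
      simp only [A, Fintype.sum_sum_type, Matrix.fromBlocks_apply₁₁, Matrix.fromBlocks_apply₁₂,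
        Matrix.fromBlocks_apply₂₁, Matrix.fromBlocks_apply₂₂, Matrix.of_apply, hsf, sum_form_diagonal,
        Finset.sum_add_distrib, form_smul, form_unit he, inner_self_eq_norm_sq,
        ← Finset.mul_sum]
      rw [Finset.sum_comm (f := fun i j => X.form (a j i) (v (Sum.inl j)) (v (Sum.inr i)))]
      simp only [form_neg_left, Finset.sum_neg_distrib, norm_neg] at h2
      linarith
  have hP := hT.formPos hA
  have hmap : A.map T = Matrix.fromBlocks (Matrix.diagonal fun _ => (C : 𝕜) • T e) (a.map T)
      ((Matrix.of fun i j => s (a j i)).map T)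
      (Matrix.diagonal fun _ => (C : 𝕜) • T e) := by
    simp only [A, Matrix.fromBlocks_map, Matrix.diagonal_map hT0, hsmul]
  rw [hmap] at hP
  intro w v
  -- Preservation of adjoints by `T` is not assumed: the symmetry contained in positivity of the
  -- image identifies its lower left corner with the adjoint of `a.map T`.
  have h2 := hP.1 (Sum.elim w 0) (Sum.elim 0 v)
  have h3 := hP.2 (Sum.elim (-w) v)
  simp only [Fintype.sum_sum_type, Matrix.fromBlocks_apply₁₁, Matrix.fromBlocks_apply₁₂,
    Matrix.fromBlocks_apply₂₁, Matrix.fromBlocks_apply₂₂, Finset.sum_add_distrib,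
    sum_form_diagonal, Sum.elim_inl, Sum.elim_inr, Pi.zero_apply, form_zero_left,
    form_zero_right, Finset.sum_const_zero, add_zero, zero_add, Pi.neg_apply, form_neg_left,
    form_neg_right, Finset.sum_neg_distrib, form_smul, form_unit hTe,
    inner_self_eq_norm_sq, ← Finset.mul_sum] at h2 h3
  linarith

/-- The block operator with rows `(1, tS)` and `(-tS, 1)` has norm at most `√(1 + t²‖S‖²) ≤ 1 +
t²‖S‖²/2`, because the terms linear in `t` cancel when `S` is symmetric. It replaces the usual `1 +
itS`, which is unavailable over `ℝ` and is not respected by real-linear maps. -/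
theorem re_inner_rotation_le {K : Type*} [NormedAddCommGroup K] [InnerProductSpace 𝕜 K]
    (S : K →L[𝕜] K) (hS : ∀ w v, re (inner 𝕜 w (S v)) = re (inner 𝕜 v (S w))) (t : ℝ)
    (w₁ w₂ v₁ v₂ : K) :
    re (inner 𝕜 w₁ v₁) + re (inner 𝕜 w₂ v₂) + t * re (inner 𝕜 w₁ (S v₂))
        - t * re (inner 𝕜 w₂ (S v₁)) ≤
      (1 + t ^ 2 * ‖S‖ ^ 2 / 2) * ((‖w₁‖ ^ 2 + ‖w₂‖ ^ 2 + (‖v₁‖ ^ 2 + ‖v₂‖ ^ 2)) / 2) := by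
  set p := v₁ + (t : 𝕜) • S v₂ with hp
  set q := v₂ - (t : 𝕜) • S v₁ with hq
  set C := 1 + t ^ 2 * ‖S‖ ^ 2 / 2 with hC
  have hC1 : 1 ≤ C := by rw [hC]; nlinarith [mul_nonneg (sq_nonneg t) (sq_nonneg ‖S‖)]
  have h1 : re (inner 𝕜 w₁ p) ≤ ‖w₁‖ * ‖p‖ := (re_le_norm _).trans (norm_inner_le_norm _ _)
  have h2 : re (inner 𝕜 w₂ q) ≤ ‖w₂‖ * ‖q‖ := (re_le_norm _).trans (norm_inner_le_norm _ _)
  have e1 : re (inner 𝕜 w₁ p) = re (inner 𝕜 w₁ v₁) + t * re (inner 𝕜 w₁ (S v₂)) := by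
    simp [hp, inner_add_right, inner_smul_right]
  have e2 : re (inner 𝕜 w₂ q) = re (inner 𝕜 w₂ v₂) - t * re (inner 𝕜 w₂ (S v₁)) := by
    simp [hq, inner_sub_right, inner_smul_right]
  have n1 : ‖p‖ ^ 2 = ‖v₁‖ ^ 2 + 2 * (t * re (inner 𝕜 v₁ (S v₂))) + t ^ 2 * ‖S v₂‖ ^ 2 := by
    rw [hp, norm_add_sq (𝕜 := 𝕜), inner_smul_right, norm_smul, norm_ofReal, mul_pow, sq_abs,
      re_ofReal_mul]
  have n2 : ‖q‖ ^ 2 = ‖v₂‖ ^ 2 - 2 * (t * re (inner 𝕜 v₂ (S v₁))) + t ^ 2 * ‖S v₁‖ ^ 2 := by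
    rw [hq, norm_sub_sq (𝕜 := 𝕜), inner_smul_right, norm_smul, norm_ofReal, mul_pow, sq_abs,
      re_ofReal_mul]
  have b1 : ‖S v₁‖ ^ 2 ≤ ‖S‖ ^ 2 * ‖v₁‖ ^ 2 := by
    rw [← mul_pow]; exact pow_le_pow_left₀ (norm_nonneg _) (S.le_opNorm _) 2
  have b2 : ‖S v₂‖ ^ 2 ≤ ‖S‖ ^ 2 * ‖v₂‖ ^ 2 := by
    rw [← mul_pow]; exact pow_le_pow_left₀ (norm_nonneg _) (S.le_opNorm _) 2
  have hP : ‖p‖ ^ 2 + ‖q‖ ^ 2 ≤ C ^ 2 * (‖v₁‖ ^ 2 + ‖v₂‖ ^ 2) := by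
    have h3 : ‖p‖ ^ 2 + ‖q‖ ^ 2 ≤ (1 + t ^ 2 * ‖S‖ ^ 2) * (‖v₁‖ ^ 2 + ‖v₂‖ ^ 2) := by
      rw [n1, n2, hS v₂ v₁]
      nlinarith [mul_le_mul_of_nonneg_left b1 (sq_nonneg t),
        mul_le_mul_of_nonneg_left b2 (sq_nonneg t)]
    refine h3.trans (mul_le_mul_of_nonneg_right ?_ (by positivity))
    rw [hC]; nlinarith [sq_nonneg (t ^ 2 * ‖S‖ ^ 2)]
  have hL : ‖w₁‖ * ‖p‖ + ‖w₂‖ * ‖q‖ ≤ C * ((‖w₁‖ ^ 2 + ‖w₂‖ ^ 2 + (‖v₁‖ ^ 2 + ‖v₂‖ ^ 2)) / 2) := by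
    refine le_of_mul_le_mul_left ?_ (by linarith : 0 < C)
    nlinarith [sq_nonneg (C * ‖w₁‖ - ‖p‖), sq_nonneg (C * ‖w₂‖ - ‖q‖)]
  linarith

/-- Unital completely contractive real-linear maps are completely positive. -/
theorem CompletelyContractive.completelyPositive (hX : X.IsUnital) {T : X.V → Y.V}
    (hadd : ∀ x y, T (x + y) = T x + T y)
    (hsmul : ∀ (r : ℝ) x, T ((r : 𝕜) • x) = (r : 𝕜) • T x) (h1 : MapsUnit T)
    (hT : CompletelyContractive T) : CompletelyPositive T := by
  obtain ⟨e, he⟩ := hX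
  have hTe := h1 e he
  have hT0 : T 0 = 0 := by simpa using hsmul 0 0
  have hTb : ∀ {ι : Type} [Fintype ι] (a : Matrix ι ι X.V) (C : ℝ), 0 ≤ C →
      FormBound X.form a C → FormBound Y.form (a.map T) C := fun a C hC ha => by
    have := (completelyBoundedBy_one_iff.2 hT).formBound zero_le_one hT0 hC ha
    rwa [one_mul] at this
  intro n x hx
  set S := X.mat x with hS
  have hx' := (matPos_iff x).1 hx
  have hsym : ∀ w v, re (inner 𝕜 w (S v)) = re (inner 𝕜 v (S w)) := fun w v => by
    rw [re_inner_mat, re_inner_mat]; exact hx'.1 w v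
  rw [matPos_iff]
  constructor
  · intro w v
    -- Self-adjointness of the image: the rotation matrix has norm `1 + O(t²)`, and so has its image
    -- under `T`, whereas an asymmetry `D` of `x.map T` would contribute a term linear in `t`.
    have hbound : ∀ t : ℝ, FormBound X.form
        (Matrix.fromBlocks (Matrix.diagonal fun _ => e) ((t : 𝕜) • x) (((-t : ℝ) : 𝕜) • x)
          (Matrix.diagonal fun _ => e)) (1 + t ^ 2 * ‖S‖ ^ 2 / 2) := by
      intro t w v
      have := re_inner_rotation_le S hsym t (WithLp.toLp 2 fun i => w (Sum.inl i))
        (WithLp.toLp 2 fun i => w (Sum.inr i)) (WithLp.toLp 2 fun i => v (Sum.inl i))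
        (WithLp.toLp 2 fun i => v (Sum.inr i))
      simp only [hS, re_inner_mat] at this
      simp only [PiLp.inner_apply, PiLp.norm_sq_eq_of_L2, map_sum] at this
      simp only [Fintype.sum_sum_type, Matrix.fromBlocks_apply₁₁, Matrix.fromBlocks_apply₁₂,
        Matrix.fromBlocks_apply₂₁, Matrix.fromBlocks_apply₂₂, Finset.sum_add_distrib,
        sum_form_diagonal, Matrix.smul_apply, form_smul, form_unit he, ← Finset.mul_sum]
      refine le_of_eq_of_le ?_ this
      ring
    have hD : ∀ t : ℝ, t * (∑ i, ∑ j, Y.form (x.map T i j) (w i) (v j)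
        - ∑ i, ∑ j, Y.form (x.map T i j) (v i) (w j))
        ≤ t ^ 2 * (‖S‖ ^ 2 / 2 * (∑ i, ‖w i‖ ^ 2 + ∑ i, ‖v i‖ ^ 2)) := by
      intro t
      have := hTb _ _ (by positivity) (hbound t) (Sum.elim w v) (Sum.elim w v)
      rw [Matrix.fromBlocks_map, Matrix.diagonal_map hT0] at this
      simp only [Fintype.sum_sum_type,
        Matrix.fromBlocks_apply₁₁, Matrix.fromBlocks_apply₁₂,
        Matrix.fromBlocks_apply₂₁, Matrix.fromBlocks_apply₂₂, Finset.sum_add_distrib,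
        sum_form_diagonal, Matrix.smul_apply, Matrix.map_apply, hsmul, form_smul, form_unit hTe,
        ← Finset.mul_sum, Sum.elim_inl, Sum.elim_inr, inner_self_eq_norm_sq] at this
      simp only [Matrix.map_apply]
      linarith
    set D := ∑ i, ∑ j, Y.form (x.map T i j) (w i) (v j)
        - ∑ i, ∑ j, Y.form (x.map T i j) (v i) (w j) with hDdef
    set N := ‖S‖ ^ 2 / 2 * (∑ i, ‖w i‖ ^ 2 + ∑ i, ‖v i‖ ^ 2) with hN
    have hN0 : 0 ≤ N := by positivity
    -- From `t D ≤ t² N` for all `t`, this value yields `(N + 1) D² ≤ N D²`; the summand `1` avoids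
    -- division by zero.
    have h2 := hD (D / (N + 1))
    have h3 : D ^ 2 ≤ 0 := by
      have hpos : 0 < N + 1 := by linarith
      rw [div_mul_eq_mul_div, div_pow, div_mul_eq_mul_div, div_le_div_iff₀ hpos (by positivity)]
        at h2
      have h4 : (N + 1) * D ^ 2 ≤ 0 := by nlinarith
      nlinarith [sq_nonneg D]
    have : D = 0 := by nlinarith [sq_nonneg D]
    linarith
  · intro v
    set C := X.matNorm x with hC
    have hC0 : 0 ≤ C := matNorm_nonneg x
    have hxC := (matNorm_le_iff x hC0).1 le_rfl
    -- Since `0 ≤ x ≤ C`, the element `C - x` has norm at most `C`. Its image `C - T x` then does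
    -- too, which forces `T x ≥ 0`.
    have hb : FormBound X.form (Matrix.diagonal (fun _ => (C : 𝕜) • e) + ((-1 : ℝ) : 𝕜) • x) C := by
      intro w v
      have h3 := hxC (fun i => w i - v i) (fun i => w i - v i)
      have h4 := hx'.1 w v
      simp only [Matrix.add_apply, form_add, Finset.sum_add_distrib, sum_form_diagonal,
        Matrix.smul_apply, form_smul, form_unit he, ← Finset.mul_sum]
      have hexp : ∑ i, ∑ j, X.form (x i j) (w i - v i) (w j - v j)
            = ∑ i, ∑ j, X.form (x i j) (w i) (w j) + ∑ i, ∑ j, X.form (x i j) (v i) (v j)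
              - 2 * ∑ i, ∑ j, X.form (x i j) (w i) (v j) := by
        have : ∀ i j, X.form (x i j) (w i - v i) (w j - v j) = X.form (x i j) (w i) (w j)
            + X.form (x i j) (v i) (v j) - X.form (x i j) (w i) (v j)
            - X.form (x i j) (v i) (w j) := fun i j => by
          simp only [form, map_sub, inner_sub_left, inner_sub_right]; ring
        simp only [this, Finset.sum_sub_distrib, Finset.sum_add_distrib]
        linarith
      have hnorm : ∑ i, ‖w i - v i‖ ^ 2
          = ∑ i, ‖w i‖ ^ 2 + ∑ i, ‖v i‖ ^ 2 - 2 * ∑ i, re (inner 𝕜 (w i) (v i)) := by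
        rw [Finset.mul_sum, ← Finset.sum_add_distrib, ← Finset.sum_sub_distrib]
        refine Finset.sum_congr rfl fun i _ => ?_
        rw [norm_sub_sq (𝕜 := 𝕜)]; ring
      rw [hnorm] at h3
      linarith [hx'.2 w, hx'.2 v, hexp]
    have h2 := hTb _ _ hC0 hb v v
    have hmap : (Matrix.diagonal (fun _ => (C : 𝕜) • e) + ((-1 : ℝ) : 𝕜) • x).map T
        = Matrix.diagonal (fun _ => (C : 𝕜) • T e) + ((-1 : ℝ) : 𝕜) • x.map T := by
      rw [Matrix.map_add _ hadd, Matrix.diagonal_map hT0]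
      ext i j
      simp only [Matrix.add_apply, Matrix.smul_apply, Matrix.map_apply, hsmul]
    rw [hmap] at h2
    simp only [Matrix.add_apply, form_add, Finset.sum_add_distrib, sum_form_diagonal,
      Matrix.smul_apply, form_smul, form_unit hTe, ← Finset.mul_sum, inner_self_eq_norm_sq] at h2
    linarith

end Forms

/-! ### Linearity over the smaller field -/

section Linear

variable {𝕜 : Type} [RCLike 𝕜] {X Y Z : OperatorSpace.{u} 𝕜} {F₂ : Type} [RCLike F₂]
  [NormedAlgebra F₂ 𝕜]

/-- A continuous additive map is real-linear, so both fields share the same copy of `ℝ`. -/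
theorem algebraMap_ofReal (r : ℝ) : algebraMap F₂ 𝕜 (r : F₂) = (r : 𝕜) := by
  have h := map_real_smul (algebraMap F₂ 𝕜) (continuous_algebraMap F₂ 𝕜) r 1
  rwa [map_one, RCLike.real_smul_eq_coe_mul, RCLike.real_smul_eq_coe_mul, mul_one, mul_one] at h

namespace IsLinearOver

theorem map_ofReal {T : X.V → Y.V} (h : IsLinearOver F₂ T) (r : ℝ) (x : X.V) :
    T ((r : 𝕜) • x) = (r : 𝕜) • T x := by
  rw [← algebraMap_ofReal (F₂ := F₂) r]; exact h.map_smul _ _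

theorem map_zero {T : X.V → Y.V} (h : IsLinearOver F₂ T) : T 0 = 0 := by
  simpa using h.map_ofReal 0 0

theorem map_sub {T : X.V → Y.V} (h : IsLinearOver F₂ T) (x y : X.V) : T (x - y) = T x - T y := by
  rw [eq_sub_iff_add_eq, ← h.map_add, sub_add_cancel]

theorem comp {S : Y.V → Z.V} {T : X.V → Y.V} (hS : IsLinearOver F₂ S) (hT : IsLinearOver F₂ T) :
    IsLinearOver F₂ (S ∘ T) :=
  ⟨fun x y => by simp [hT.map_add, hS.map_add], fun c x => by simp [hT.map_smul, hS.map_smul]⟩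

theorem of_linearMap (T : X.V →ₗ[𝕜] Y.V) : IsLinearOver (X := X) (Y := Y) F₂ T :=
  ⟨T.map_add, fun _ => T.map_smul _⟩

theorem of_real_of_I {T : X.V → Y.V} (hadd : ∀ x y, T (x + y) = T x + T y)
    (hreal : ∀ (r : ℝ) x, T ((r : 𝕜) • x) = (r : 𝕜) • T x)
    (hI : ∀ x, T (algebraMap F₂ 𝕜 RCLike.I • x) = algebraMap F₂ 𝕜 RCLike.I • T x) :
    IsLinearOver F₂ T := by
  refine ⟨hadd, fun c x => ?_⟩
  rw [← RCLike.re_add_im c, _root_.map_add, _root_.map_mul, algebraMap_ofReal, algebraMap_ofReal,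
    add_smul, add_smul, mul_smul, mul_smul, hadd, hreal, hreal, hI]

end IsLinearOver

theorem norm_toOp_eq_matNorm (x : X.V) :
    ‖X.toOp x‖ = X.matNorm (Matrix.of fun _ _ : Fin 1 => x) := by
  rw [OperatorSpace.matNorm, OperatorSpace.mat, norm_matOp_one]
  rfl

theorem CompletelyBoundedBy.norm_le {T : X.V → Y.V} {c : ℝ} (h : CompletelyBoundedBy T c)
    (x : X.V) : ‖Y.toOp (T x)‖ ≤ c * ‖X.toOp x‖ := by
  rw [norm_toOp_eq_matNorm, norm_toOp_eq_matNorm]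
  exact h 1 _

theorem CompletelyIsometric.norm_eq {T : X.V → Y.V} (h : CompletelyIsometric T)
    (x : X.V) : ‖Y.toOp (T x)‖ = ‖X.toOp x‖ := by
  rw [norm_toOp_eq_matNorm, norm_toOp_eq_matNorm]
  exact h 1 _

theorem CompletelyIsometric.injective {T : X.V → Y.V} (h : CompletelyIsometric T)
    (hT : IsLinearOver F₂ T) : Function.Injective T := by
  intro x y hxy
  have h1 := h.norm_eq (x - y)
  rw [hT.map_sub, hxy, sub_self, _root_.map_zero, norm_zero, eq_comm, norm_eq_zero] at h1
  exact sub_eq_zero.1 (X.toOp_injective (by rw [h1, _root_.map_zero]))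

end Linear

/-! ### Extension of completely bounded maps into `B(H)` -/

section Wittstock

open RCLike

variable {𝕜 : Type} [RCLike 𝕜]

/-- The operator space `B(H)`. -/
def fullSpace (𝕜 : Type) [RCLike 𝕜] (H : Type u) [NormedAddCommGroup H] [InnerProductSpace 𝕜 H]
    [CompleteSpace H] : OperatorSpace.{u} 𝕜 where
  V := H →L[𝕜] H
  H := H
  toOp := LinearMap.id
  toOp_injective := Function.injective_id

/-- Trilinearity over the reals. -/
structure IsRealTrilinear {V H : Type*} [AddCommGroup V] [Module 𝕜 V] [NormedAddCommGroup H]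
    [InnerProductSpace 𝕜 H] (g : V → H → H → ℝ) : Prop where
  add₁ : ∀ b b' h k, g (b + b') h k = g b h k + g b' h k
  add₂ : ∀ b h h' k, g b (h + h') k = g b h k + g b h' k
  add₃ : ∀ b h k k', g b h (k + k') = g b h k + g b h k'
  smul₁ : ∀ (r : ℝ) b h k, g ((r : 𝕜) • b) h k = r * g b h k
  smul₂ : ∀ (r : ℝ) b h k, g b ((r : 𝕜) • h) k = r * g b h k
  smul₃ : ∀ (r : ℝ) b h k, g b h ((r : 𝕜) • k) = r * g b h k

variable {A B Y : OperatorSpace.{u} 𝕜}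

theorem isRealTrilinear_form (X : OperatorSpace.{u} 𝕜) : IsRealTrilinear (𝕜 := 𝕜) X.form where
  add₁ := OperatorSpace.form_add
  add₂ _ _ _ _ := by simp [OperatorSpace.form, inner_add_left]
  add₃ _ _ _ _ := by simp [OperatorSpace.form, inner_add_right]
  smul₁ := OperatorSpace.form_smul
  smul₂ _ _ _ _ := by simp [OperatorSpace.form, inner_smul_left]
  smul₃ _ _ _ _ := by simp [OperatorSpace.form, inner_smul_right]

theorem IsRealTrilinear.le_mul {V H : Type*} [AddCommGroup V] [Module 𝕜 V] [NormedAddCommGroup H]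
    [InnerProductSpace 𝕜 H] {g : V → H → H → ℝ} (hg : IsRealTrilinear (𝕜 := 𝕜) g) {b : V} {C : ℝ}
    (hC : ∀ h k, g b h k ≤ C * ((‖h‖ ^ 2 + ‖k‖ ^ 2) / 2)) (h k : H) :
    g b h k ≤ C * (‖h‖ * ‖k‖) := by
  rcases eq_or_ne h 0 with rfl | hh
  · have := hg.smul₂ 0 b 0 k
    simp at this
    simp [this]
  rcases eq_or_ne k 0 with rfl | hk
  · have := hg.smul₃ 0 b h 0
    simp at this
    simp [this]
  have hh' : 0 < ‖h‖ := norm_pos_iff.2 hh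
  have hk' : 0 < ‖k‖ := norm_pos_iff.2 hk
  have h1 := hC ((‖k‖ : 𝕜) • h) ((‖h‖ : 𝕜) • k)
  rw [hg.smul₂, hg.smul₃, norm_smul, norm_smul, norm_ofReal, norm_ofReal, abs_norm, abs_norm] at h1
  refine le_of_mul_le_mul_left ?_ (mul_pos hh' hk')
  nlinarith

/-- The trilinear form of a real-linear map, as a bundled map. -/
def bundleTrilinear {V H : Type*} [AddCommGroup V] [Module 𝕜 V] [NormedAddCommGroup H]
    [InnerProductSpace 𝕜 H] [Module ℝ V] [IsScalarTower ℝ 𝕜 V] [Module ℝ H] [IsScalarTower ℝ 𝕜 H]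
    (g : V → H → H → ℝ) (hg : IsRealTrilinear (𝕜 := 𝕜) g) :
    V →ₗ[ℝ] H →ₗ[ℝ] H →ₗ[ℝ] ℝ where
  toFun b := LinearMap.mk₂ ℝ (g b) (hg.add₂ b)
    (fun r h k => by
      rw [← algebraMap_smul 𝕜 r h, algebraMap_eq_ofReal, hg.smul₂, smul_eq_mul]) (hg.add₃ b)
    (fun r h k => by
      rw [← algebraMap_smul 𝕜 r k, algebraMap_eq_ofReal, hg.smul₃, smul_eq_mul])
  map_add' b b' := by ext h k; exact hg.add₁ b b' h k
  map_smul' r b := by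
    ext h k
    change g (r • b) h k = r * g b h k
    rw [← algebraMap_smul 𝕜 r b, algebraMap_eq_ofReal, hg.smul₁]

theorem FormBound.of_forall_gt {V H : Type*} [Norm H] {g : V → H → H → ℝ} {ι κ : Type} [Fintype ι]
    [Fintype κ] {b : Matrix ι κ V} {c C : ℝ} (hc : 0 ≤ c)
    (h : ∀ D, C < D → FormBound g b (c * D)) : FormBound g b (c * C) := by
  intro w v
  refine le_of_forall_pos_le_add fun ε hε => ?_
  set N := (∑ i, ‖w i‖ ^ 2 + ∑ j, ‖v j‖ ^ 2) / 2 with hN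
  have hN0 : 0 ≤ N := by positivity
  have hcN : 0 < c * N + 1 := by positivity
  refine (h (C + ε / (c * N + 1)) (by linarith [div_pos hε hcN]) w v).trans ?_
  rw [← hN]
  have : c * N * (ε / (c * N + 1)) ≤ ε := by
    rw [mul_div_assoc', div_le_iff₀ hcN]; nlinarith
  nlinarith

theorem exists_form_extension {κ : A.V → B.V} {φ : A.V → Y.V}
    (hκadd : ∀ x y, κ (x + y) = κ x + κ y) (hκr : ∀ (r : ℝ) x, κ ((r : 𝕜) • x) = (r : 𝕜) • κ x)
    (hφadd : ∀ x y, φ (x + y) = φ x + φ y) (hφr : ∀ (r : ℝ) x, φ ((r : 𝕜) • x) = (r : 𝕜) • φ x)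
    (hκ : CompletelyIsometric κ) (hinj : Function.Injective κ) {c : ℝ} (hc : 0 ≤ c)
    (hφ : CompletelyBoundedBy φ c) :
    ∃ g : B.V → Y.H → Y.H → ℝ, IsRealTrilinear (𝕜 := 𝕜) g ∧
      (∀ a h k, g (κ a) h k = Y.form (φ a) h k) ∧
      ∀ (ι ι' : Type) [Fintype ι] [Fintype ι'] (b : Matrix ι ι' B.V) (C : ℝ), 0 ≤ C →
        FormBound B.form b C → FormBound g b (c * C) := by
  let : Module ℝ A.V := Module.compHom A.V (algebraMap ℝ 𝕜)
  let : Module ℝ B.V := Module.compHom B.V (algebraMap ℝ 𝕜)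
  have : IsScalarTower ℝ 𝕜 A.V := IsScalarTower.of_algebraMap_smul fun _ _ => rfl
  have : IsScalarTower ℝ 𝕜 B.V := IsScalarTower.of_algebraMap_smul fun _ _ => rfl
  let : InnerProductSpace ℝ B.H := InnerProductSpace.rclikeToReal 𝕜 B.H
  let : InnerProductSpace ℝ Y.H := InnerProductSpace.rclikeToReal 𝕜 Y.H
  have : IsScalarTower ℝ 𝕜 B.H := IsScalarTower.of_algebraMap_smul fun _ _ => rfl
  have : IsScalarTower ℝ 𝕜 Y.H := IsScalarTower.of_algebraMap_smul fun _ _ => rfl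
  have hκ0 : κ 0 = 0 := by simpa using hκr 0 0
  have hφ0 : φ 0 = 0 := by simpa using hφr 0 0
  let κ' : A.V →ₗ[ℝ] B.V :=
    { toFun := κ
      map_add' := hκadd
      map_smul' := fun r x => by
        simp only [← algebraMap_smul 𝕜 r, algebraMap_eq_ofReal, RingHom.id_apply]
        exact hκr r x }
  have hY := isRealTrilinear_form Y
  have hφtri : IsRealTrilinear (𝕜 := 𝕜) (fun (a : A.V) (h k : Y.H) => Y.form (φ a) h k) :=
    ⟨fun b b' h k => by rw [hφadd, hY.add₁], fun b => hY.add₂ _, fun b => hY.add₃ _,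
      fun r b h k => by rw [hφr, hY.smul₁], fun r b => hY.smul₂ r _, fun r b => hY.smul₃ r _⟩
  obtain ⟨g, hg1, hg2⟩ := exists_trilinear_extension
    (bundleTrilinear B.form (isRealTrilinear_form B))
    (fun b => ⟨‖B.toOp b‖, fun w v => OperatorSpace.form_le b w v⟩) (κ := κ') hinj
    (φ := bundleTrilinear _ hφtri) hc (fun ι ι' _ _ a ha => by
      have ha' : FormBound B.form (a.map κ) 1 := ha
      have h1 := formBound_of_matNorm_le (S := κ) (T := id) (X := B) (Y := A) zero_le_one hκ0 rfl
        (fun n a => by rw [one_mul, Matrix.map_id]; exact (hκ n a).ge) zero_le_one ha'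
      rw [Matrix.map_id, mul_one] at h1
      have h2 := hφ.formBound hc hφ0 zero_le_one h1
      rw [mul_one] at h2
      exact h2)
  have hgr₁ : ∀ (r : ℝ) b h k, g ((r : 𝕜) • b) h k = r * g b h k := fun r b h k => by
    rw [← algebraMap_eq_ofReal, algebraMap_smul, map_smul, LinearMap.smul_apply,
      LinearMap.smul_apply, smul_eq_mul]
  refine ⟨fun b h k => g b h k, ⟨by simp, by simp, by simp, hgr₁, fun r b h k => ?_,
    fun r b h k => ?_⟩, fun a h k => ?_, fun ι ι' _ _ b C hC hb => ?_⟩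
  · rw [← algebraMap_eq_ofReal, algebraMap_smul, map_smul, LinearMap.smul_apply, smul_eq_mul]
  · rw [← algebraMap_eq_ofReal, algebraMap_smul, map_smul, smul_eq_mul]
  · exact congrFun (congrArg DFunLike.coe (congrFun (congrArg DFunLike.coe (hg1 a)) h)) k
  -- The extension controls only matrices bounded by one. As `C` may vanish, the normalization
  -- divides by an arbitrary `D > C`.
  · refine .of_forall_gt hc fun D hD => ?_
    have hD0 : 0 < D := hC.trans_lt hD
    have h1 : FormBound B.form (((D⁻¹ : ℝ) : 𝕜) • b) 1 := fun w v => by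
      have h2 := hb w v
      simp only [Matrix.smul_apply, OperatorSpace.form_smul, ← Finset.mul_sum]
      rw [inv_mul_le_iff₀ hD0, one_mul]
      exact h2.trans (mul_le_mul_of_nonneg_right hD.le (by positivity))
    intro w v
    have h2 := hg2 ι ι' _ h1 w v
    simp only [Matrix.smul_apply, hgr₁, ← Finset.mul_sum] at h2
    rw [inv_mul_le_iff₀ hD0] at h2
    linarith

/-- A dominated trilinear extension of the form of `φ` along `κ`. -/
structure IsFormExtension (κ : A.V → B.V) (φ : A.V → Y.V) (c : ℝ) (g : B.V → Y.H → Y.H → ℝ) :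
    Prop where
  tri : IsRealTrilinear (𝕜 := 𝕜) g
  ext : ∀ a h k, g (κ a) h k = Y.form (φ a) h k
  bound : ∀ (ι ι' : Type) [Fintype ι] [Fintype ι'] (b : Matrix ι ι' B.V) (C : ℝ), 0 ≤ C →
    FormBound B.form b C → FormBound g b (c * C)

/-- Averaging a form extension with its transform under compatible unimodular scalars. -/
theorem IsFormExtension.average {κ : A.V → B.V} {φ : A.V → Y.V} {c : ℝ} {g : B.V → Y.H → Y.H → ℝ}
    (hg : IsFormExtension κ φ c g) {p q r : 𝕜} (hp : ‖p‖ = 1) (hq : ‖q‖ = 1) (hr : ‖r‖ = 1)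
    (hpqr : starRingEnd 𝕜 q * (p * r) = 1) (hκ : ∀ a, κ (p • a) = p • κ a)
    (hφ : ∀ a, φ (p • a) = p • φ a) :
    IsFormExtension κ φ c fun b h k => (g b h k + g (p • b) (q • h) (r • k)) / 2 := by
  refine ⟨⟨?_, ?_, ?_, ?_, ?_, ?_⟩, ?_, ?_⟩
  · intro b b' h k; rw [smul_add, hg.tri.add₁, hg.tri.add₁]; ring
  · intro b h h' k; rw [smul_add, hg.tri.add₂, hg.tri.add₂]; ring
  · intro b h k k'; rw [smul_add, hg.tri.add₃, hg.tri.add₃]; ring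
  · intro t b h k; rw [smul_comm, hg.tri.smul₁, hg.tri.smul₁]; ring
  · intro t b h k; rw [smul_comm q, hg.tri.smul₂, hg.tri.smul₂]; ring
  · intro t b h k; rw [smul_comm r, hg.tri.smul₃, hg.tri.smul₃]; ring
  · intro a h k
    rw [← hκ, hg.ext, hg.ext, hφ]
    have : Y.form (p • φ a) (q • h) (r • k) = Y.form (φ a) h k := by
      simp only [OperatorSpace.form, map_smul, smul_apply, inner_smul_left,
        inner_smul_right]
      congr 1
      calc _ = starRingEnd 𝕜 q * (p * r) * inner 𝕜 h (Y.toOp (φ a) k) := by ring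
        _ = _ := by rw [hpqr, one_mul]
    rw [this]; ring
  · intro ι ι' _ _ b C hC hb w v
    have hb' : FormBound B.form (p • b) C := fun w v => by
      have h1 := hb (fun i => starRingEnd 𝕜 p • w i) v
      simp only [norm_smul, RCLike.norm_conj, hp, one_mul] at h1
      refine le_of_eq_of_le ?_ h1
      simp [OperatorSpace.form, inner_smul_left, inner_smul_right]
    have h1 := hg.bound ι ι' b C hC hb w v
    have h2 := hg.bound ι ι' _ C hC hb' (fun i => q • w i) (fun j => r • v j)
    simp only [norm_smul, hq, hr, one_mul, Matrix.smul_apply] at h2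
    simp only [← Finset.sum_div, Finset.sum_add_distrib]
    linarith

theorem conj_eq_neg_of_mul_self {p : 𝕜} (hp : ‖p‖ = 1) (h : p * p = -1) :
    starRingEnd 𝕜 p = -p := by
  have h1 : starRingEnd 𝕜 p * p = 1 := by rw [RCLike.conj_mul, hp]; simp
  calc starRingEnd 𝕜 p = -(starRingEnd 𝕜 p * (p * p)) := by rw [h]; ring
    _ = -p := by rw [← mul_assoc, h1, one_mul]

variable {F₂ : Type} [RCLike F₂] [NormedAlgebra F₂ 𝕜]

theorem norm_eq_one_of_mul_self {p : 𝕜} (h : p * p = -1) : ‖p‖ = 1 := by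
  have h1 : ‖p‖ * ‖p‖ = 1 := by rw [← norm_mul, h, norm_neg, norm_one]
  nlinarith [norm_nonneg p]

/-- Hahn–Banach gives only a real form. Averaging with scalars `(1, I, I)` yields the relation that
makes the future operators `𝕜`-linear. Averaging with `(v, v, 1)`, where `v` is the image of the
imaginary unit of `F₂`, yields `F₂`-linearity in `b`; the first relation survives because scalars
commute. One average suffices since these units square to `-1`, and if a unit is zero its relation
is trivial. -/
theorem exists_invariant_form_extension {κ : A.V → B.V} {φ : A.V → Y.V}
    (hκl : IsLinearOver F₂ κ) (hφl : IsLinearOver F₂ φ) (hκ : CompletelyIsometric κ) {c : ℝ}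
    (hc : 0 ≤ c) (hφ : CompletelyBoundedBy φ c) :
    ∃ g, IsFormExtension κ φ c g ∧ (∀ b h k, g b h ((I : 𝕜) • k) = -g b ((I : 𝕜) • h) k) ∧
      ∀ b h k, g (algebraMap F₂ 𝕜 I • b) h k = -g b (algebraMap F₂ 𝕜 I • h) k := by
  obtain ⟨g₀, h1, h2, h3⟩ := exists_form_extension hκl.map_add hκl.map_ofReal hφl.map_add
    hφl.map_ofReal hκ (hκ.injective hκl) hc hφ
  have hg₀ : IsFormExtension κ φ c g₀ := ⟨h1, h2, h3⟩
  have hneg₂ : ∀ {g}, IsFormExtension κ φ c g → ∀ b h k, g b (-h) k = -g b h k :=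
    fun hg b h k => by
      have := hg.tri.smul₂ (-1) b h k
      simpa using this
  have hneg₁ : ∀ {g}, IsFormExtension κ φ c g → ∀ b h k, g (-b) h k = -g b h k :=
    fun hg b h k => by
      have := hg.tri.smul₁ (-1) b h k
      simpa using this
  have hneg₃ : ∀ {g}, IsFormExtension κ φ c g → ∀ b h k, g b h (-k) = -g b h k :=
    fun hg b h k => by
      have := hg.tri.smul₃ (-1) b h k
      simpa using this
  obtain ⟨g₁, hg₁, hI₁⟩ : ∃ g, IsFormExtension κ φ c g ∧
      ∀ b h k, g b h ((I : 𝕜) • k) = -g b ((I : 𝕜) • h) k := by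
    rcases I_mul_I (K := 𝕜) with hI | hI
    · refine ⟨g₀, hg₀, fun b h k => ?_⟩
      have e2 := h1.smul₂ 0 b 0 k
      have e3 := h1.smul₃ 0 b h 0
      simp at e2 e3
      simp [hI, e2, e3]
    · have hn := norm_eq_one_of_mul_self hI
      refine ⟨_, hg₀.average (p := 1) (q := I) (r := I) norm_one hn hn ?_ (by simp) (by simp),
        fun b h k => ?_⟩
      · rw [one_mul, RCLike.conj_mul, hn]; simp
      · simp only [smul_smul, hI, neg_smul, one_smul, hneg₂ hg₀, hneg₃ hg₀]
        ring
  set v := algebraMap F₂ 𝕜 I with hv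
  rcases I_mul_I (K := F₂) with hI | hI
  · refine ⟨g₁, hg₁, hI₁, fun b h k => ?_⟩
    have e1 := hg₁.tri.smul₁ 0 0 h k
    have e2 := hg₁.tri.smul₂ 0 b 0 k
    simp at e1 e2
    simp [hv, hI, e1, e2]
  · have hvv : v * v = -1 := by rw [hv, ← map_mul, hI, map_neg, map_one]
    have hn := norm_eq_one_of_mul_self hvv
    refine ⟨_, hg₁.average (p := v) (q := v) (r := 1) hn hn norm_one ?_ (hκl.map_smul _)
      (hφl.map_smul _), fun b h k => ?_, fun b h k => ?_⟩
    · rw [mul_one, RCLike.conj_mul, hn]; simp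
    · simp only [one_smul, hI₁, smul_comm v (I : 𝕜)]
      ring
    · simp only [smul_smul, hvv, neg_smul, one_smul, hneg₂ hg₁, hneg₁ hg₁]
      ring

theorem exists_re_inner_eq {H : Type*} [NormedAddCommGroup H] [InnerProductSpace 𝕜 H]
    [CompleteSpace H] {f : H → ℝ} {C : ℝ} (hadd : ∀ x y, f (x + y) = f x + f y)
    (hsmul : ∀ (r : ℝ) x, f ((r : 𝕜) • x) = r * f x) (hC : ∀ x, f x ≤ C * ‖x‖) :
    ∃ y, ∀ x, re (inner 𝕜 x y) = f x := by
  let : InnerProductSpace ℝ H := InnerProductSpace.rclikeToReal 𝕜 H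
  have : IsScalarTower ℝ 𝕜 H := IsScalarTower.of_algebraMap_smul fun _ _ => rfl
  let F : H →ₗ[ℝ] ℝ :=
    { toFun := f
      map_add' := hadd
      map_smul' := fun r x => by
        rw [← algebraMap_smul 𝕜 r x, algebraMap_eq_ofReal, hsmul]; rfl }
  let F' : StrongDual ℝ H := F.mkContinuous C fun x => by
    rw [Real.norm_eq_abs, abs_le]
    have h1 := hC (-x)
    have h2 : f (-x) = -f x := F.map_neg x
    rw [norm_neg, h2] at h1
    exact ⟨by change _ ≤ f x; linarith, hC x⟩
  refine ⟨(InnerProductSpace.toDual ℝ H).symm F', fun x => ?_⟩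
  rw [← real_inner_eq_re_inner, real_inner_comm, InnerProductSpace.toDual_symm_apply]
  rfl

theorem eq_of_re_inner_eq {H : Type*} [NormedAddCommGroup H] [InnerProductSpace 𝕜 H]
    {y z : H} (h : ∀ x, re (inner 𝕜 x y) = re (inner 𝕜 x z)) : y = z := by
  have h1 := h (y - z)
  rw [← sub_eq_zero, ← map_sub, ← inner_sub_right, inner_self_eq_norm_sq] at h1
  exact sub_eq_zero.1 (norm_eq_zero.1 (pow_eq_zero_iff two_ne_zero |>.1 h1))

/-- Completely bounded maps into an operator space on `H` extend, with the same bound, along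
complete isometries to maps into `B(H)`. -/
theorem exists_completelyBounded_extension {κ : A.V → B.V} {φ : A.V → Y.V}
    (hκl : IsLinearOver F₂ κ) (hφl : IsLinearOver F₂ φ) (hκ : CompletelyIsometric κ) {c : ℝ}
    (hc : 0 ≤ c) (hφ : CompletelyBoundedBy φ c) :
    ∃ ψ : B.V → (fullSpace 𝕜 Y.H).V, IsLinearOver F₂ ψ ∧ CompletelyBoundedBy ψ c ∧
      ∀ a, ψ (κ a) = Y.toOp (φ a) := by
  obtain ⟨g, ⟨htri, hext, hbound⟩, hI, hI₂⟩ := exists_invariant_form_extension hκl hφl hκ hc hφ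
  have hle : ∀ b h k, g b h k ≤ c * ‖B.toOp b‖ * (‖h‖ * ‖k‖) := fun b h k => by
    refine htri.le_mul (fun h k => ?_) h k
    have h1 := hbound Unit Unit (fun _ _ => b) ‖B.toOp b‖ (norm_nonneg _) (fun w v => by
      have := OperatorSpace.form_le b (w ()) (v ())
      simp only [Finset.univ_unique, Finset.sum_singleton]
      refine this.trans (mul_le_mul_of_nonneg_left ?_ (norm_nonneg _))
      change ‖w ()‖ * ‖v ()‖ ≤ (‖w ()‖ ^ 2 + ‖v ()‖ ^ 2) / 2
      nlinarith [sq_nonneg (‖w ()‖ - ‖v ()‖)]) (fun _ => h) (fun _ => k)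
    simpa using h1
  -- For fixed `b` and `k` the form is a bounded real functional of `h`; the vector representing it
  -- is the value at `k` of the operator assigned to `b`.
  have hriesz : ∀ b k, ∃ y, ∀ h, re (inner 𝕜 h y) = g b h k := fun b k =>
    exists_re_inner_eq (C := c * ‖B.toOp b‖ * ‖k‖) (fun h h' => htri.add₂ b h h' k)
      (fun r h => htri.smul₂ r b h k) (fun h => (hle b h k).trans (by linarith))
  choose y hy using hriesz
  have hyle : ∀ b k, ‖y b k‖ ≤ c * ‖B.toOp b‖ * ‖k‖ := fun b k => by
    have h1 := hle b (y b k) k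
    rw [← hy, inner_self_eq_norm_sq] at h1
    rcases (norm_nonneg (y b k)).eq_or_lt with h0 | h0
    · rw [← h0]; positivity
    · refine le_of_mul_le_mul_left ?_ h0
      nlinarith
  have hconjI : starRingEnd 𝕜 (I : 𝕜) = -I := RCLike.conj_I
  have hconjv : starRingEnd 𝕜 (algebraMap F₂ 𝕜 I) = -algebraMap F₂ 𝕜 I := by
    rcases I_mul_I (K := F₂) with h | h
    · simp [h]
    · have hvv : algebraMap F₂ 𝕜 I * algebraMap F₂ 𝕜 I = -1 := by
        rw [← map_mul, h, map_neg, map_one]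
      exact conj_eq_neg_of_mul_self (norm_eq_one_of_mul_self hvv) hvv
  have hneg₂ : ∀ b h k, g b (-h) k = -g b h k := fun b h k => by
    have := htri.smul₂ (-1) b h k
    simpa using this
  have hadd₃ : ∀ b k k', y b (k + k') = y b k + y b k' := fun b k k' =>
    eq_of_re_inner_eq (𝕜 := 𝕜) fun h => by
      rw [hy, inner_add_right, map_add, hy, hy, htri.add₃]
  have hreal₃ : ∀ (r : ℝ) b k, y b ((r : 𝕜) • k) = (r : 𝕜) • y b k := fun r b k =>
    eq_of_re_inner_eq (𝕜 := 𝕜) fun h => by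
      rw [hy, inner_smul_right, re_ofReal_mul, hy, htri.smul₃]
  have hI₃ : ∀ b k, y b ((I : 𝕜) • k) = (I : 𝕜) • y b k := fun b k =>
    eq_of_re_inner_eq (𝕜 := 𝕜) fun h => by
      have : inner 𝕜 h ((I : 𝕜) • y b k) = inner 𝕜 (-(I : 𝕜) • h) (y b k) := by
        rw [inner_smul_right, inner_smul_left, map_neg, hconjI, neg_neg]
      rw [this, hy, hy, hI, neg_smul, hneg₂]
  let ψ : B.V → (fullSpace 𝕜 Y.H).V := fun b =>
    LinearMap.mkContinuous
      { toFun := y b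
        map_add' := hadd₃ b
        map_smul' := fun z k => by
          rw [← RCLike.re_add_im z, RingHom.id_apply, add_smul, add_smul, mul_smul, mul_smul,
            hadd₃, hreal₃, hreal₃, hI₃] }
      (c * ‖B.toOp b‖) (hyle b)
  refine ⟨ψ, .of_real_of_I ?_ ?_ ?_, .of_formBound hc fun n a C hC ha => ?_, fun a => ?_⟩
  · intro b b'
    refine ContinuousLinearMap.ext fun k => eq_of_re_inner_eq (𝕜 := 𝕜) fun h => ?_
    change re (inner 𝕜 h (y (b + b') k)) = re (inner 𝕜 h (y b k + y b' k))
    rw [hy, inner_add_right, map_add, hy, hy, htri.add₁]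
  · intro r b
    refine ContinuousLinearMap.ext fun k => eq_of_re_inner_eq (𝕜 := 𝕜) fun h => ?_
    change re (inner 𝕜 h (y ((r : 𝕜) • b) k)) = re (inner 𝕜 h ((r : 𝕜) • y b k))
    rw [hy, inner_smul_right, re_ofReal_mul, hy, htri.smul₁]
  · intro b
    refine ContinuousLinearMap.ext fun k => eq_of_re_inner_eq (𝕜 := 𝕜) fun h => ?_
    change re (inner 𝕜 h (y (algebraMap F₂ 𝕜 I • b) k))
      = re (inner 𝕜 h (algebraMap F₂ 𝕜 I • y b k))
    have : inner 𝕜 h (algebraMap F₂ 𝕜 I • y b k)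
        = inner 𝕜 (-(algebraMap F₂ 𝕜 I) • h) (y b k) := by
      rw [inner_smul_right, inner_smul_left, map_neg, hconjv, neg_neg]
    rw [this, hy, hy, hI₂, neg_smul, hneg₂]
  · intro w v
    refine le_of_eq_of_le ?_ (hbound _ _ a C hC ha w v)
    exact Finset.sum_congr rfl fun i _ => Finset.sum_congr rfl fun j _ => hy _ _ _
  · refine ContinuousLinearMap.ext fun k => eq_of_re_inner_eq (𝕜 := 𝕜) fun h => ?_
    change re (inner 𝕜 h (y (κ a) k)) = _
    rw [hy, hext]
    rfl

end Wittstock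

/-! ### Matrix norms of `ℓ^∞(G, X)` -/

section EllInf

open RCLike

variable {𝕜 : Type} [RCLike 𝕜] {G : Type u} {X Z : OperatorSpace.{u} 𝕜}
  {F₂ : Type} [RCLike F₂] [NormedAlgebra F₂ 𝕜]

/-- Evaluation at `s` on `ℓ^∞(G, X)`. -/
def coord (s : G) (f : (ellInf G X).V) : X.V := f.1 s

theorem ellInf_ext {f g : (ellInf G X).V} (h : ∀ s, coord s f = coord s g) : f = g :=
  Subtype.ext (funext h)

/-- The operator on `ℓ²(G, H)` given by an element of `ℓ^∞(G, X)`. -/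
def ellOp (f : (ellInf G X).V) : lp (fun _ : G => X.H) 2 →L[𝕜] lp (fun _ : G => X.H) 2 :=
  (ellInf G X).toOp f

theorem ellOp_apply (f : (ellInf G X).V) (v : lp (fun _ : G => X.H) 2) (s : G) :
    ellOp f v s = X.toOp (coord s f) (v s) := rfl

/-- The real form of `ℓ^∞(G, X)` on `ℓ²(G, H)`. -/
def ellForm (f : (ellInf G X).V) (w v : lp (fun _ : G => X.H) 2) : ℝ := re (inner 𝕜 w (ellOp f v))

theorem hasSum_ellForm (f : (ellInf G X).V) (w v : lp (fun _ : G => X.H) 2) :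
    HasSum (fun s => X.form (coord s f) (w s) (v s)) (ellForm f w v) :=
  (RCLike.reCLM (K := 𝕜)).hasSum (lp.hasSum_inner (𝕜 := 𝕜) w (ellOp f v))

theorem hasSum_norm_sq_lp {H : Type*} [NormedAddCommGroup H] [InnerProductSpace 𝕜 H]
    (w : lp (fun _ : G => H) 2) : HasSum (fun s => ‖w s‖ ^ 2) (‖w‖ ^ 2) := by
  have h := (RCLike.reCLM (K := 𝕜)).hasSum (lp.hasSum_inner (𝕜 := 𝕜) w w)
  simpa only [RCLike.reCLM_apply, Function.comp_def, inner_self_eq_norm_sq] using h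

theorem formBound_ellForm {ι κ : Type} [Fintype ι] [Fintype κ] {F : Matrix ι κ (ellInf G X).V}
    {C : ℝ} (h : ∀ s, FormBound X.form (F.map (coord s)) C) : FormBound ellForm F C := by
  intro w v
  have h1 : HasSum (fun s => ∑ i, ∑ j, X.form (coord s (F i j)) (w i s) (v j s))
      (∑ i, ∑ j, ellForm (F i j) (w i) (v j)) :=
    hasSum_sum fun i _ => hasSum_sum fun j _ => hasSum_ellForm _ _ _
  have h2 : HasSum (fun s => C * ((∑ i, ‖w i s‖ ^ 2 + ∑ j, ‖v j s‖ ^ 2) / 2))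
      (C * ((∑ i, ‖w i‖ ^ 2 + ∑ j, ‖v j‖ ^ 2) / 2)) :=
    (((hasSum_sum fun i _ => hasSum_norm_sq_lp (𝕜 := 𝕜) (w i)).add
      (hasSum_sum fun j _ => hasSum_norm_sq_lp (𝕜 := 𝕜) (v j))).div_const 2).mul_left C
  exact hasSum_le (fun s => h s (fun i => w i s) (fun j => v j s)) h1 h2

theorem ellForm_single [DecidableEq G] (f : (ellInf G X).V) (s : G) (w v : X.H) :
    ellForm f (lp.single (E := fun _ : G => X.H) 2 s w) (lp.single (E := fun _ : G => X.H) 2 s v)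
      = X.form (coord s f) w v := by
  rw [ellForm, lp.inner_single_left, ellOp_apply, lp.single_apply_self, OperatorSpace.form]

theorem norm_single_lp [DecidableEq G] {H : Type*} [NormedAddCommGroup H] (s : G) (w : H) :
    ‖lp.single (E := fun _ : G => H) 2 s w‖ = ‖w‖ :=
  lp.norm_single (E := fun _ : G => H) (p := 2) (by norm_num) s w

theorem formBound_coord_of_ellForm {ι κ : Type} [Fintype ι] [Fintype κ]
    {F : Matrix ι κ (ellInf G X).V} {C : ℝ} (h : FormBound ellForm F C) (s : G) :
    FormBound X.form (F.map (coord s)) C := by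
  classical
  intro w v
  have h1 := h (fun i => lp.single (E := fun _ : G => X.H) 2 s (w i))
    (fun j => lp.single (E := fun _ : G => X.H) 2 s (v j))
  simp only [ellForm_single, norm_single_lp] at h1
  exact h1

/-- The form of a diagonal operator is the sum of its coordinate forms, so coordinatewise bounds add
up; conversely, vectors supported at `s` isolate one coordinate. -/
theorem formBound_ellInf_iff {ι κ : Type} [Fintype ι] [Fintype κ]
    {F : Matrix ι κ (ellInf G X).V} {C : ℝ} :
    FormBound (ellInf G X).form F C ↔ ∀ s, FormBound X.form (F.map (coord s)) C :=
  ⟨fun h s => formBound_coord_of_ellForm h s, fun h => formBound_ellForm h⟩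

theorem completelyContractive_coord (s : G) :
    CompletelyContractive (X := ellInf G X) (Y := X) (coord s) := by
  rw [← completelyBoundedBy_one_iff]
  refine .of_formBound zero_le_one fun n a C _ ha => ?_
  rw [one_mul]
  exact formBound_ellInf_iff.1 ha s

theorem toOp_ellInf_eq_one_iff {f : (ellInf G X).V} :
    (ellInf G X).toOp f = 1 ↔ ∀ s, X.toOp (coord s f) = 1 := by
  classical
  change ellOp f = 1 ↔ _
  constructor
  · intro h s
    ext w
    have h1 := ellOp_apply f (lp.single (E := fun _ : G => X.H) 2 s w) s
    rw [h, one_apply_eq_self, lp.single_apply_self] at h1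
    exact h1.symm
  · intro h
    refine ContinuousLinearMap.ext fun v => lp.ext (funext fun s => ?_)
    rw [ellOp_apply, h s]
    rfl

theorem isObject_ellInf (G : Type u) {k : Kind} (hX : k.IsObject X) : k.IsObject (ellInf G X) := by
  have hunit : X.IsUnital → (ellInf G X).IsUnital := by
    rintro ⟨e, he⟩
    exact ⟨⟨fun _ => e, ‖X.toOp e‖, fun _ => le_rfl⟩, toOp_ellInf_eq_one_iff.2 fun s => he⟩
  cases k with
  | OSp => trivial
  | OSp1 => exact hunit hX
  | OSy =>
    refine ⟨hunit hX.1, fun f => ?_⟩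
    choose s hs using hX.2
    obtain ⟨C, hC⟩ := f.2
    refine ⟨⟨fun t => s (coord t f), C, fun t => ?_⟩, ?_⟩
    · rw [hs, ContinuousLinearMap.star_eq_adjoint, LinearIsometryEquiv.norm_map]
      exact hC t
    · change ellOp _ = ContinuousLinearMap.adjoint (ellOp f)
      rw [ContinuousLinearMap.eq_adjoint_iff]
      intro x y
      rw [lp.inner_eq_tsum, lp.inner_eq_tsum]
      refine tsum_congr fun t => ?_
      change inner 𝕜 (X.toOp (s (coord t f)) _) _ = _
      rw [hs, ContinuousLinearMap.star_eq_adjoint, ContinuousLinearMap.adjoint_inner_left]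
      rfl

/-- The map into `ℓ^∞(G, X)` whose coordinates are a uniformly bounded family of maps. -/
def ofFamily {c : ℝ} (T : G → Z.V → X.V) (hT : ∀ s, CompletelyBoundedBy (T s) c) (z : Z.V) :
    (ellInf G X).V :=
  ⟨fun s => T s z, c * ‖Z.toOp z‖, fun s => (hT s).norm_le z⟩

variable {c : ℝ} {T : G → Z.V → X.V} (hT : ∀ s, CompletelyBoundedBy (T s) c)

theorem isLinearOver_ofFamily (h : ∀ s, IsLinearOver F₂ (T s)) :
    IsLinearOver F₂ (ofFamily T hT) :=
  ⟨fun x y => ellInf_ext fun s => (h s).map_add x y,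
    fun c x => ellInf_ext fun s => (h s).map_smul c x⟩

theorem completelyBoundedBy_ofFamily (hc : 0 ≤ c) (h0 : ∀ s, T s 0 = 0) :
    CompletelyBoundedBy (ofFamily T hT) c :=
  .of_formBound hc fun _ _ _ hC ha => formBound_ellInf_iff.2 fun s => (hT s).formBound hc (h0 s) hC ha

theorem mapsUnit_ofFamily (h : ∀ s, MapsUnit (T s)) : MapsUnit (ofFamily T hT) := fun z hz =>
  toOp_ellInf_eq_one_iff.2 fun s => h s z hz

end EllInf

/-! ### Completely bounded norms -/

section CbNorm

variable {𝕜 : Type} [RCLike 𝕜] {X Y Z : OperatorSpace.{u} 𝕜}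

theorem cbNorm_le {T : X.V → Y.V} {c : ℝ} (hc : 0 ≤ c) (h : CompletelyBoundedBy T c) :
    cbNorm T ≤ ENNReal.ofReal c :=
  iSup_le fun n => iSup_le fun a => iSup_le fun ha => ENNReal.ofReal_le_ofReal <|
    (h n a).trans (mul_le_of_le_one_right hc ha)

theorem matNorm_smul {n : ℕ} (r : ℝ) (a : Matrix (Fin n) (Fin n) X.V) :
    X.matNorm ((r : 𝕜) • a) = |r| * X.matNorm a := by
  have : X.mat ((r : 𝕜) • a) = (r : 𝕜) • X.mat a := by
    ext v i
    simp [OperatorSpace.mat, matOp_apply, Finset.smul_sum]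
  rw [OperatorSpace.matNorm, this, norm_smul, RCLike.norm_ofReal, OperatorSpace.matNorm]

theorem CompletelyBoundedBy.comp {S : Y.V → Z.V} {T : X.V → Y.V} {c d : ℝ} (hc : 0 ≤ c)
    (hS : CompletelyBoundedBy S c) (hT : CompletelyBoundedBy T d) :
    CompletelyBoundedBy (S ∘ T) (c * d) := fun n a => by
  rw [← Matrix.map_map, mul_assoc]
  exact (hS n _).trans (mul_le_mul_of_nonneg_left (hT n a) hc)

theorem CompletelyBoundedBy.mono {T : X.V → Y.V} {c d : ℝ} (h : CompletelyBoundedBy T c)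
    (hcd : c ≤ d) : CompletelyBoundedBy T d := fun n a =>
  (h n a).trans (mul_le_mul_of_nonneg_right hcd (matNorm_nonneg a))

theorem CompletelyContractive.cbNorm_le_one {T : X.V → Y.V} (h : CompletelyContractive T) :
    cbNorm T ≤ 1 := by
  simpa using cbNorm_le zero_le_one (completelyBoundedBy_one_iff.2 h)

/-- A completely contractive real-homogeneous map is completely bounded by its cb norm. -/
theorem CompletelyContractive.completelyBoundedBy_cbNorm {T : X.V → Y.V}
    (h : CompletelyContractive T) (hsmul : ∀ (r : ℝ) x, T ((r : 𝕜) • x) = (r : 𝕜) • T x) :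
    CompletelyBoundedBy T (cbNorm T).toReal := by
  intro n a
  have hfin : cbNorm T ≠ ∞ := ne_top_of_le_ne_top ENNReal.one_ne_top h.cbNorm_le_one
  rcases (matNorm_nonneg a).eq_or_lt with h0 | h0
  -- A matrix of norm zero cannot be normalized; contractivity settles this case directly.
  · rw [← h0, mul_zero, h0]; exact h n a
  set r := (X.matNorm a)⁻¹ with hr
  have hr0 : 0 < r := inv_pos.2 h0
  have h1 : X.matNorm ((r : 𝕜) • a) ≤ 1 := by
    rw [matNorm_smul, abs_of_pos hr0, hr, inv_mul_cancel₀ h0.ne']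
  have h2 : ENNReal.ofReal (Y.matNorm (((r : 𝕜) • a).map T)) ≤ cbNorm T :=
    le_iSup_of_le n (le_iSup_of_le _ (le_iSup_of_le h1 le_rfl))
  have h3 : ((r : 𝕜) • a).map T = (r : 𝕜) • a.map T := by
    ext i j; simp [hsmul]
  rw [ENNReal.ofReal_le_iff_le_toReal hfin, h3, matNorm_smul, abs_of_pos hr0, hr,
    inv_mul_le_iff₀ h0] at h2
  linarith

theorem cbNorm_le_of_extension {κ : X.V → Y.V} {φ : X.V → Z.V} {ψ : Y.V → Z.V}
    (hκ : CompletelyIsometric κ) (h : ∀ x, ψ (κ x) = φ x) : cbNorm φ ≤ cbNorm ψ := by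
  refine iSup_le fun n => iSup_le fun a => iSup_le fun ha => ?_
  refine le_iSup_of_le n (le_iSup_of_le (a.map κ) (le_iSup_of_le ((hκ n a).trans_le ha) ?_))
  have : (a.map κ).map ψ = a.map φ := by ext i j; simp [h]
  rw [this]

theorem cbNorm_eq_of_extension {κ : X.V → Y.V} {φ : X.V → Z.V} {ψ : Y.V → Z.V}
    (hκ : CompletelyIsometric κ) (hφ : CompletelyContractive φ) (h : ∀ x, ψ (κ x) = φ x)
    (hψ : CompletelyBoundedBy ψ (cbNorm φ).toReal) : cbNorm ψ = cbNorm φ := by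
  refine le_antisymm ((cbNorm_le ENNReal.toReal_nonneg hψ).trans_eq ?_)
    (cbNorm_le_of_extension hκ h)
  exact ENNReal.ofReal_toReal (ne_top_of_le_ne_top ENNReal.one_ne_top hφ.cbNorm_le_one)

theorem CompletelyContractive.toReal_cbNorm_le_one {T : X.V → Y.V} (h : CompletelyContractive T) :
    (cbNorm T).toReal ≤ 1 :=
  ENNReal.toReal_le_of_le_ofReal zero_le_one (by simpa using h.cbNorm_le_one)

end CbNorm

/-! ### A uniform description of the three kinds of categories -/

section Kinds

variable {𝕜 : Type} [RCLike 𝕜] {X Y : OperatorSpace.{u} 𝕜} {k : Kind}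
  {F₂ : Type} [RCLike F₂] [NormedAlgebra F₂ 𝕜]

theorem Kind.isMorphism_iff (hX : k.IsObject X) {T : X.V → Y.V} :
    k.IsMorphism F₂ T ↔
      IsLinearOver F₂ T ∧ (k ≠ Kind.OSp → MapsUnit T) ∧ CompletelyContractive T := by
  cases k with
  | OSp => simp [Kind.IsMorphism]
  | OSp1 => simp [Kind.IsMorphism]
  | OSy =>
    simp only [Kind.IsMorphism, ne_eq, reduceCtorEq, not_false_eq_true, forall_const]
    refine and_congr_right fun hl => and_congr_right fun h1 => ⟨fun h => ?_, fun h => ?_⟩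
    · exact h.completelyContractive hX hl.map_ofReal h1
    · exact h.completelyPositive hX.1 hl.map_add hl.map_ofReal h1

theorem Kind.isEmbedding_iff {T : X.V → Y.V} :
    k.IsEmbedding F₂ T ↔
      IsLinearOver F₂ T ∧ (k ≠ Kind.OSp → MapsUnit T) ∧ CompletelyIsometric T := by
  cases k <;> simp [Kind.IsEmbedding]

theorem Kind.IsEmbedding.isMorphism (hX : k.IsObject X) {T : X.V → Y.V}
    (h : k.IsEmbedding F₂ T) : k.IsMorphism F₂ T := by
  rw [Kind.isEmbedding_iff] at h
  exact (Kind.isMorphism_iff hX).2 ⟨h.1, h.2.1, fun n a => (h.2.2 n a).le⟩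

theorem Kind.IsMorphism.comp {Z : OperatorSpace.{u} 𝕜} (hX : k.IsObject X) (hY : k.IsObject Y)
    {S : Y.V → Z.V} {T : X.V → Y.V} (hS : k.IsMorphism F₂ S) (hT : k.IsMorphism F₂ T) :
    k.IsMorphism F₂ (S ∘ T) := by
  rw [Kind.isMorphism_iff hX] at hT ⊢
  rw [Kind.isMorphism_iff hY] at hS
  refine ⟨hS.1.comp hT.1, fun hk x hx => hS.2.1 hk _ (hT.2.1 hk _ hx), fun n a => ?_⟩
  rw [← Matrix.map_map]
  exact (hS.2.2 n _).trans (hT.2.2 n a)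

theorem Kind.isMorphism_id (hX : k.IsObject X) : k.IsMorphism F₂ (X := X) (Y := X) id :=
  (Kind.isMorphism_iff hX).2 ⟨⟨fun _ _ => rfl, fun _ _ => rfl⟩, fun _ _ h => h, fun n a => by
    rw [Matrix.map_id]⟩

theorem Kind.IsObject.isUnital (hX : k.IsObject X) (hk : k ≠ Kind.OSp) : X.IsUnital := by
  cases k with
  | OSp => exact absurd rfl hk
  | OSp1 => exact hX
  | OSy => exact hX.1

/-- An extension of a unital map along a unital map is unital. -/
theorem mapsUnit_of_extension {Z : OperatorSpace.{u} 𝕜} {κ : X.V → Y.V} {φ : X.V → Z.V}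
    {ψ : Y.V → Z.V} (hX : X.IsUnital) (hκ : MapsUnit κ) (hφ : MapsUnit φ)
    (h : ∀ x, ψ (κ x) = φ x) : MapsUnit ψ := by
  obtain ⟨e, he⟩ := hX
  intro y hy
  have : y = κ e := Y.toOp_injective (by rw [hy, hκ e he])
  rw [this, h]
  exact hφ e he

variable {G : Type u} [Group G]

theorem completelyIsometric_of_representation {ρ : Representation 𝕜 G X.V}
    (h : ∀ g, CompletelyContractive (X := X) (Y := X) (ρ g)) (g : G) :
    CompletelyIsometric (X := X) (Y := X) (ρ g) := fun n a => by
  refine le_antisymm (h g n a) ?_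
  have h1 := h g⁻¹ n (a.map (ρ g))
  have h2 : (a.map (ρ g)).map (ρ g⁻¹) = a := by
    ext i j
    simp
  rwa [h2] at h1

theorem GObject.mapsUnit_act (X : GObject k 𝕜 G) (hk : k ≠ Kind.OSp) (g : G) :
    MapsUnit (X := X.space) (Y := X.space) (X.act g) := by
  obtain ⟨S, hS, ρ, hρ⟩ := X
  cases k with
  | OSp => exact absurd rfl hk
  | OSp1 => exact (hρ g).1
  | OSy => exact (hρ g).1

theorem GObject.completelyIsometric_act (X : GObject k 𝕜 G) (g : G) :
    CompletelyIsometric (X := X.space) (Y := X.space) (X.act g) := by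
  obtain ⟨S, hS, ρ, hρ⟩ := X
  cases k with
  | OSp => exact hρ g
  | OSp1 => exact (hρ g).2
  | OSy =>
    refine completelyIsometric_of_representation (fun g => ?_) g
    have hl := IsLinearOver.of_linearMap (F₂ := 𝕜) (X := S) (Y := S) (ρ g)
    exact CompletelyPositive.completelyContractive hS hl.map_ofReal (hρ g).1
      fun n a => ((hρ g).2 n a).1

theorem Kind.isActionMap_of_contractive (hX : k.IsObject X) {ρ : Representation 𝕜 G X.V}
    (h1 : ∀ g, k ≠ Kind.OSp → MapsUnit (X := X) (Y := X) (ρ g))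
    (h : ∀ g, CompletelyContractive (X := X) (Y := X) (ρ g)) (g : G) : k.IsActionMap (ρ g) := by
  have hiso := completelyIsometric_of_representation h
  cases k with
  | OSp => exact hiso g
  | OSp1 => exact ⟨h1 g (by simp), hiso g⟩
  | OSy =>
    have hpos : ∀ g, CompletelyPositive (X := X) (Y := X) (ρ g) := fun g => by
      have hl := IsLinearOver.of_linearMap (F₂ := 𝕜) (X := X) (Y := X) (ρ g)
      exact (h g).completelyPositive hX.1 hl.map_add hl.map_ofReal (h1 g (by simp))
    refine ⟨h1 g (by simp), fun n a => ⟨hpos g n a, fun ha => ?_⟩⟩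
    have h2 := hpos g⁻¹ n _ ha
    have h3 : (a.map (ρ g)).map (ρ g⁻¹) = a := by
      ext i j
      simp
    rwa [h3] at h2

theorem isObject_fullSpace (k : Kind) (H : Type u) [NormedAddCommGroup H] [InnerProductSpace 𝕜 H]
    [CompleteSpace H] : k.IsObject (fullSpace 𝕜 H) := by
  have h1 : (fullSpace 𝕜 H).IsUnital := ⟨(1 : H →L[𝕜] H), rfl⟩
  cases k with
  | OSp => trivial
  | OSp1 => exact h1
  | OSy => exact ⟨h1, fun x => ⟨(star ((fullSpace 𝕜 H).toOp x) : H →L[𝕜] H), rfl⟩⟩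

/-- `ℓ^∞(G, Y)` with the translation action. -/
def ellInfObject (G : Type u) [Group G] (hY : k.IsObject Y) : GObject k 𝕜 G where
  space := ellInf G Y
  isObject := isObject_ellInf G hY
  act := translation G Y
  isActionMap := Kind.isActionMap_of_contractive (isObject_ellInf G hY)
    (fun g _ f hf => toOp_ellInf_eq_one_iff.2 fun s => toOp_ellInf_eq_one_iff.1 hf (g⁻¹ * s))
    fun g => by
      rw [← completelyBoundedBy_one_iff]
      refine .of_formBound zero_le_one fun n a C _ ha => ?_
      rw [one_mul]
      exact formBound_ellInf_iff.2 fun s => formBound_ellInf_iff.1 ha (g⁻¹ * s)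

/-! ### Orbit maps -/

variable {B : GObject k 𝕜 G}

theorem GObject.completelyBoundedBy_comp_act {T : B.space.V → Y.V} {c : ℝ}
    (hT : CompletelyBoundedBy T c) (g : G) : CompletelyBoundedBy (T ∘ B.act g) c := fun n a => by
  rw [← Matrix.map_map, ← B.completelyIsometric_act g n a]
  exact hT n _

/-- The map `b ↦ (s ↦ T (s⁻¹ b))`. -/
def orbitMap {c : ℝ} (T : B.space.V → Y.V) (hT : CompletelyBoundedBy T c) :
    B.space.V → (ellInf G Y).V :=
  ofFamily (fun s => T ∘ B.act s⁻¹) fun s => GObject.completelyBoundedBy_comp_act hT s⁻¹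

theorem coord_orbitMap {c : ℝ} {T : B.space.V → Y.V} (hT : CompletelyBoundedBy T c) (s : G)
    (b : B.space.V) : coord s (orbitMap T hT b) = T (B.act s⁻¹ b) := rfl

theorem isEquivariant_orbitMap {c : ℝ} {T : B.space.V → Y.V} (hT : CompletelyBoundedBy T c) :
    IsEquivariant (X := B.space) (Y := ellInf G Y) B.act (translation G Y) (orbitMap T hT) := by
  intro g b
  refine ellInf_ext fun s => ?_
  change T (B.act s⁻¹ (B.act g b)) = T (B.act (g⁻¹ * s)⁻¹ b)
  rw [mul_inv_rev, inv_inv, map_mul]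
  rfl

theorem isLinearOver_orbitMap {c : ℝ} {T : B.space.V → Y.V} (hT : CompletelyBoundedBy T c)
    (h : IsLinearOver F₂ T) : IsLinearOver F₂ (orbitMap T hT) :=
  isLinearOver_ofFamily _ fun s => h.comp (.of_linearMap (B.act s⁻¹))

theorem completelyBoundedBy_orbitMap {c : ℝ} (hc : 0 ≤ c) {T : B.space.V → Y.V}
    (hT : CompletelyBoundedBy T c) (h0 : T 0 = 0) : CompletelyBoundedBy (orbitMap T hT) c :=
  completelyBoundedBy_ofFamily _ hc fun s => by simp [h0]

theorem isEmbedding_orbitMap {T : B.space.V → Y.V} (hT : CompletelyBoundedBy T 1)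
    (h : k.IsEmbedding F₂ T) : k.IsEmbedding F₂ (orbitMap T hT) := by
  rw [Kind.isEmbedding_iff] at h ⊢
  refine ⟨isLinearOver_orbitMap hT h.1, fun hk => ?_, fun n a => le_antisymm ?_ ?_⟩
  · exact mapsUnit_ofFamily _ fun s x hx => h.2.1 hk _ (B.mapsUnit_act hk s⁻¹ x hx)
  · simpa using completelyBoundedBy_orbitMap zero_le_one hT h.1.map_zero n a
  -- The coordinate at `1` of the orbit map is `T` itself, which gives the lower bound.
  · have h1 := completelyContractive_coord (X := Y) (1 : G) n (a.map (orbitMap T hT))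
    have h2 : (a.map (orbitMap T hT)).map (coord 1) = a.map T := by
      ext i j
      simp [coord_orbitMap]
    rw [h2, h.2.2 n a] at h1
    exact h1

end Kinds

/-! ### The characterization of injectivity -/

section Main

variable {𝕜 : Type} [RCLike 𝕜] {k : Kind} {F₂ : Type} [RCLike F₂] [NormedAlgebra F₂ 𝕜]
  {G : Type u} [Group G] (X : GObject k 𝕜 G)

theorem completelyBoundedBy_id (Y : OperatorSpace.{u} 𝕜) :
    CompletelyBoundedBy (X := Y) (Y := Y) id 1 := fun n a => by
  rw [Matrix.map_id, one_mul]

theorem isEmbedding_id (Y : OperatorSpace.{u} 𝕜) : k.IsEmbedding F₂ (X := Y) (Y := Y) id :=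
  Kind.isEmbedding_iff.2
    ⟨⟨fun _ _ => rfl, fun _ _ => rfl⟩, fun _ _ h => h, fun n a => by rw [Matrix.map_id]⟩

theorem GObject.j_eq_orbitMap : X.j = orbitMap (B := X) id (completelyBoundedBy_id X.space) := rfl

theorem GObject.isEmbedding_j : k.IsEmbedding F₂ (X := X.space) (Y := ellInf G X.space) X.j :=
  isEmbedding_orbitMap (completelyBoundedBy_id X.space) (isEmbedding_id X.space)

theorem GObject.isEquivariant_j :
    IsEquivariant (X := X.space) (Y := ellInf G X.space) X.act (translation G X.space) X.j :=
  isEquivariant_orbitMap (completelyBoundedBy_id X.space)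

theorem completelyBoundedBy_toOp (Y : OperatorSpace.{u} 𝕜) :
    CompletelyBoundedBy (X := Y) (Y := fullSpace 𝕜 Y.H) Y.toOp 1 := fun n a => by
  rw [one_mul]; rfl

theorem isEmbedding_toOp (Y : OperatorSpace.{u} 𝕜) :
    k.IsEmbedding F₂ (X := Y) (Y := fullSpace 𝕜 Y.H) Y.toOp :=
  Kind.isEmbedding_iff.2 ⟨IsLinearOver.of_linearMap (Y := fullSpace 𝕜 Y.H) Y.toOp, fun _ _ h => h,
    fun _ _ => rfl⟩

variable {X}

/-- A `G`-injective object is a retract of every `ℓ^∞(G, Y)` into which it embeds by an orbit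
map. -/
theorem IsGInjective.exists_retraction (hX : IsGInjective F₂ X) {Y : OperatorSpace.{u} 𝕜}
    (hY : k.IsObject Y) {T : X.space.V → Y.V} (hT : CompletelyBoundedBy T 1)
    (h : k.IsEmbedding F₂ T) :
    ∃ r : (ellInf G Y).V → X.space.V, k.IsMorphism F₂ r ∧
      IsEquivariant (translation G Y) X.act r ∧ ∀ x, r (orbitMap T hT x) = x := by
  obtain ⟨r, h1, h2, h3, -⟩ := hX X (ellInfObject G hY) (orbitMap T hT)
    (isEmbedding_orbitMap hT h) (isEquivariant_orbitMap hT) id (Kind.isMorphism_id X.isObject)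
    fun _ _ => rfl
  exact ⟨r, h1, h2, h3⟩

/-- Retracting from `ℓ^∞(G, B(H))` rather than from `ℓ^∞(G, X)` is what helps: its coordinates lie
in `B(H)`, where extensions are available without any injectivity of `X`. -/
theorem IsGInjective.isInjective (hX : IsGInjective F₂ X) : IsInjective k F₂ X.space := by
  intro A B hA hB κ hκ φ hφ
  rw [Kind.isEmbedding_iff] at hκ
  rw [Kind.isMorphism_iff hA] at hφ
  have hfull := isObject_fullSpace (𝕜 := 𝕜) k X.space.H
  obtain ⟨r, hr, -, hrJ⟩ := hX.exists_retraction hfull (completelyBoundedBy_toOp X.space)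
    (isEmbedding_toOp X.space)
  rw [Kind.isMorphism_iff (isObject_ellInf G hfull)] at hr
  have hc : 0 ≤ (cbNorm φ).toReal := ENNReal.toReal_nonneg
  have hφc := hφ.2.2.completelyBoundedBy_cbNorm hφ.1.map_ofReal
  -- The twist by `s⁻¹` makes the bundled extension restrict to the orbit map of `φ a`, on which `r`
  -- returns `φ a`. Each extension has the same constant, because the action is completely
  -- isometric.
  have hext : ∀ s : G, ∃ ψ : B.V → (fullSpace 𝕜 X.space.H).V, IsLinearOver F₂ ψ ∧
      CompletelyBoundedBy ψ (cbNorm φ).toReal ∧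
      ∀ a, ψ (κ a) = X.space.toOp (X.act s⁻¹ (φ a)) := fun s =>
    exists_completelyBounded_extension hκ.1
      ((IsLinearOver.of_linearMap (X := X.space) (Y := X.space) (X.act s⁻¹)).comp hφ.1) hκ.2.2 hc
      fun n a => by
        rw [← Matrix.map_map, X.completelyIsometric_act]
        exact hφc n a
  choose ψ hψl hψb hψ using hext
  have hb : CompletelyBoundedBy (r ∘ ofFamily ψ hψb) (cbNorm φ).toReal := by
    have := (completelyBoundedBy_one_iff.2 hr.2.2).comp zero_le_one
      (completelyBoundedBy_ofFamily hψb hc fun s => (hψl s).map_zero)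
    rwa [one_mul] at this
  have he : ∀ a, (r ∘ ofFamily ψ hψb) (κ a) = φ a := fun a => by
    rw [← hrJ (φ a)]
    exact congrArg r (ellInf_ext fun s => hψ s a)
  refine ⟨r ∘ ofFamily ψ hψb, (Kind.isMorphism_iff hB).2 ⟨?_, fun hk => ?_, ?_⟩, he,
    cbNorm_eq_of_extension hκ.2.2 hφ.2.2 he hb⟩
  · exact hr.1.comp (isLinearOver_ofFamily hψb hψl)
  · exact mapsUnit_of_extension (hA.isUnital hk) (hκ.2.1 hk) (hφ.2.1 hk) he
  · exact completelyBoundedBy_one_iff.1 (hb.mono hφ.2.2.toReal_cbNorm_le_one)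

theorem IsGInjective.exists_idempotent (hX : IsGInjective F₂ X) :
    ∃ φ : (ellInf G X.space).V → (ellInf G X.space).V, k.IsMorphism F₂ φ ∧
      IsEquivariant (translation G X.space) (translation G X.space) φ ∧
      (∀ f, φ (φ f) = φ f) ∧ Set.range φ = Set.range X.j ∧ ∀ x, φ (X.j x) = X.j x := by
  obtain ⟨r, hr, heq, hrj⟩ := hX.exists_retraction X.isObject (completelyBoundedBy_id X.space)
    (isEmbedding_id X.space)
  rw [← X.j_eq_orbitMap] at hrj
  refine ⟨X.j ∘ r, (X.isEmbedding_j.isMorphism X.isObject).comp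
    (isObject_ellInf G X.isObject) X.isObject hr, fun g f => ?_, fun f => ?_, ?_, fun x => ?_⟩
  · rw [Function.comp_apply, heq, X.isEquivariant_j]; rfl
  · simp only [Function.comp_apply, hrj]
  · refine Set.Subset.antisymm (Set.range_comp_subset_range _ _) ?_
    rintro _ ⟨x, rfl⟩
    exact ⟨X.j x, by rw [Function.comp_apply, hrj]⟩
  · rw [Function.comp_apply, hrj]

theorem IsInjective.isGInjective (hX : IsInjective k F₂ X.space)
    {φ : (ellInf G X.space).V → (ellInf G X.space).V} (hφ : k.IsMorphism F₂ φ)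
    (heq : IsEquivariant (translation G X.space) (translation G X.space) φ)
    (hrange : Set.range φ = Set.range X.j) (hj : ∀ x, φ (X.j x) = X.j x) :
    IsGInjective F₂ X := by
  intro A B κ hκ hκG η hη hηG
  obtain ⟨ψ, hψ, hψκ, hψn⟩ := hX A.space B.space A.isObject B.isObject κ hκ η hη
  rw [Kind.isEmbedding_iff] at hκ
  rw [Kind.isMorphism_iff A.isObject] at hη
  rw [Kind.isMorphism_iff B.isObject] at hψ
  rw [Kind.isMorphism_iff (isObject_ellInf G X.isObject)] at hφ
  have hc : 0 ≤ (cbNorm η).toReal := ENNReal.toReal_nonneg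
  have hψc := hψ.2.2.completelyBoundedBy_cbNorm hψ.1.map_ofReal
  rw [hψn] at hψc
  have hjE := X.isEmbedding_j (F₂ := F₂)
  rw [Kind.isEmbedding_iff] at hjE
  have hjinj := hjE.2.2.injective hjE.1
  -- `θ` is `j⁻¹ ∘ φ ∘ orbitMap ψ`. Since `j` is an injective, equivariant complete isometry, every
  -- property of `θ` is checked after applying `j`.
  have hθ : ∀ b, ∃ x, X.j x = φ (orbitMap ψ hψc b) := fun b => by
    have : φ (orbitMap ψ hψc b) ∈ Set.range X.j := hrange ▸ Set.mem_range_self _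
    exact this
  choose θ hθ using hθ
  have hlin := hφ.1.comp (isLinearOver_orbitMap hψc hψ.1)
  have hb : CompletelyBoundedBy θ (cbNorm η).toReal := fun n b => by
    have h1 := (completelyBoundedBy_one_iff.2 hφ.2.2).comp zero_le_one
      (completelyBoundedBy_orbitMap hc hψc hψ.1.map_zero) n b
    have h2 : b.map (φ ∘ orbitMap ψ hψc) = (b.map θ).map X.j := by
      ext i j
      simp [hθ]
    rwa [h2, hjE.2.2, one_mul] at h1
  have he : ∀ a, θ (κ a) = η a := fun a => hjinj <| by
    rw [hθ, ← hj (η a)]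
    congr 1
    -- Equivariance of `κ` and `η` enters here: on the image of `κ` the orbit map of `ψ` is already
    -- `j ∘ η`, which `φ` fixes.
    refine ellInf_ext fun s => ?_
    change ψ (B.act s⁻¹ (κ a)) = X.act s⁻¹ (η a)
    rw [← hκG, hψκ, hηG]
  refine ⟨θ, (Kind.isMorphism_iff B.isObject).2 ⟨⟨fun x y => hjinj ?_, fun c x => hjinj ?_⟩,
    fun hk => ?_, ?_⟩, fun g x => hjinj ?_, he, cbNorm_eq_of_extension hκ.2.2 hη.2.2 he hb⟩
  · rw [hjE.1.map_add, hθ, hθ, hθ]; exact hlin.map_add x y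
  · rw [hjE.1.map_smul, hθ, hθ]; exact hlin.map_smul c x
  · exact mapsUnit_of_extension (A.isObject.isUnital hk) (hκ.2.1 hk) (hη.2.1 hk) he
  · exact completelyBoundedBy_one_iff.1 (hb.mono hη.2.2.toReal_cbNorm_le_one)
  · rw [X.isEquivariant_j, hθ, hθ, isEquivariant_orbitMap, heq]

end Main

end OpSp

end

theorem mainTheorem6 {F₁ F₂ : Type} [RCLike F₁] [RCLike F₂] [NormedAlgebra F₂ F₁]
    {G : Type*} [Group G] (k : OpSp.Kind) (X : OpSp.GObject k F₁ G) :
    OpSp.IsGInjective F₂ X ↔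
      OpSp.IsInjective k F₂ X.space ∧
      ∃ φ : (OpSp.ellInf G X.space).V → (OpSp.ellInf G X.space).V,
        k.IsMorphism F₂ φ ∧
        OpSp.IsEquivariant (OpSp.translation G X.space) (OpSp.translation G X.space) φ ∧
        (∀ f, φ (φ f) = φ f) ∧
        Set.range φ = Set.range X.j ∧
        ∀ x, φ (X.j x) = X.j x := by
  refine ⟨fun h => ⟨h.isInjective, h.exists_idempotent⟩, ?_⟩
  rintro ⟨hX, φ, hφ, heq, -, hrange, hj⟩
  exact hX.isGInjective hφ heq hrange hj
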